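/- Let $L_n\subset\mathbb R^2$ ($n\ge 1$) be the circle with centre $(1/n,0)$ and radius $1/n$, and let $\mathbb H=\bigcup_{n\ge1}L_n$ be the Hawaiian earring with the metric $d(x,y)=\|x-y\|$ if $x,y$ lie on a common $L_n$, and $d(x,y)=\|x\|+\|y\|$ otherwise. Let $H_1(\mathbb H)$ be its first singular homology group and $H_1^L(\mathbb H)$ its first singular Lipschitz homology group (the homology of the complex of chains on Lipschitz simplices), both with integral coefficients. The maximal divisible subgroup of an abelian group is its largest divisible subgroup. For $n\ge1$ put $\lambda(n)=\frac1{2^n\,n!}$ and let $\varphi_n:[0,1]\to L_n$, $\varphi_n(t)=\bigl(-\tfrac{\cos 2\pi t}{n}+\tfrac1n,\ \tfrac{\sin 2\pi t}{n}\bigr)$. Let $B$ be the set of non-empty finite sequences $s=\langle s(1),\dots,s(\ell(s))\rangle$ of integers with $1\le s(i)\le i$, ordered lexicographically (a proper initial segment of a sequence being smaller than the sequence), and let $\tau(s)=\sum_{t\in B,\ t\prec s}\lambda(\ell(t))$. Write $s+\langle 1\rangle$ for the sequence $s$ with a last entry $1$ appended. Call a sequence of integers $n_k\ge1$ ($k\ge1$)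 admissible if $4\cdot\frac{2\pi}{n_k}\le\lambda(k)$ and $n_{k+1}>n_k+1$ for all $k\ge 1$. For an admissible sequence let $c_k:[0,\lambda(k)]\to\mathbb H$ be the commutator loop $\varphi_{n_k}\cdot\varphi_{n_k+1}\cdot\varphi_{n_k}^{-1}\cdot\varphi_{n_k+1}^{-1}:[0,4]\to\mathbb H$ precomposed with $t\mapsto 4t/\lambda(k)$. Admissible sequences exist, and for every admissible sequence $(n_k)$ the following hold. 1. There is a unique $1$-Lipschitz map $\sigma_1:[0,1]\to\mathbb H$ such that $\sigma_1(t)=c_{\ell(s)}(t-\tau(s))$ for all $s\in B$ and $t\in[\tau(s),\tau(s+\langle1\rangle)]$. For $n\ge1$ the formula $\sigma_n(t)=\sigma_1\bigl(t+\tau(\langle1,\dots,1\rangle)\bigr)$ (with $n$ entries $1$) defines a Lipschitz loop $\sigma_n:[0,2\lambda(n)]\to\mathbb H$ based at the origin $o=(0,0)$; for $n=1$ it is $\sigma_1$ itself. 2. $[\sigma_{n-1}]=n\,[\sigma_n]$ in $H_1^L(\mathbb H)$ for all $n\ge2$, and $[\sigma_1]$ lies in the maximal divisible subgroup of $H_1^L(\mathbb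 H)$. 3. The class of $\sigma_1$ in $\pi_1(\mathbb H,o)$ does not lie in the commutator subgroup of $\pi_1(\mathbb H,o)$. 4. The image of $[\sigma_1]$ under the comparison homomorphism $H_1^L(\mathbb H)\to H_1(\mathbb H)$ induced by the inclusion of Lipschitz chains into all singular chains is nonzero. Consequently the maximal divisible subgroups of $H_1^L(\mathbb H)$ and of $H_1(\mathbb H)$ are both nontrivial. -/

import Mathlib

noncomputable section

namespace HawaiianEarring

/-! ### Divisible subgroups -/

/-- A subgroup `D` is divisible if every `x ∈ D` is, for every `l ≥ 1`, of the form `l • y`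
with `y ∈ D`. -/
def IsDivisible {A : Type*} [AddCommGroup A] (D : AddSubgroup A) : Prop :=
  ∀ l : ℕ, 1 ≤ l → ∀ x ∈ D, ∃ y ∈ D, l • y = x

/-- The maximal divisible subgroup, i.e. the subgroup generated by all divisible subgroups. -/
def maximalDivisible (A : Type*) [AddCommGroup A] : AddSubgroup A :=
  sSup {D | IsDivisible D}

/-- The maximal divisible subgroup is the greatest divisible subgroup. -/
theorem isGreatest_maximalDivisible (A : Type*) [AddCommGroup A] :
    IsGreatest {D : AddSubgroup A | IsDivisible D} (maximalDivisible A) := by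
  refine ⟨fun l hl x hx => ?_, fun D hD => le_sSup hD⟩
  have h : maximalDivisible A ≤ (maximalDivisible A).map (nsmulAddMonoidHom l) := by
    refine sSup_le fun D hD x hx => ?_
    obtain ⟨y, hy, rfl⟩ := hD l hl x hx
    exact ⟨y, (le_sSup hD : D ≤ maximalDivisible A) hy, rfl⟩
  exact h hx

/-! ### Singular homology and singular Lipschitz homology -/

section

open CategoryTheory Simplicial

/-- The first singular homology group with integral coefficients. -/
abbrev H1 (X : Type) [TopologicalSpace X] : AddCommGrpCat.{0} :=
  ((AlgebraicTopology.singularHomologyFunctor AddCommGrpCat.{0} 1).obj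
    (AddCommGrpCat.of ℤ)).obj (TopCat.of X)

/-- The linear maps between standard simplices induced by maps of vertices are Lipschitz. -/
theorem exists_lipschitzWith_map {m n : ℕ} (f : Fin (m + 1) → Fin (n + 1)) :
    ∃ K, LipschitzWith K (stdSimplex.map (S := ℝ) f) := by
  let L : (Fin (m + 1) → ℝ) →L[ℝ] (Fin (n + 1) → ℝ) :=
    LinearMap.toContinuousLinearMap (FunOnFinite.linearMap ℝ ℝ f)
  refine ⟨‖L‖₊, fun x y => ?_⟩
  exact L.lipschitz (x : Fin (m + 1) → ℝ) y

/-- The simplicial subset of the singular simplicial set of a metric space `X` that consists of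
the Lipschitz maps `Δⁿ → X`. (Whether a map is Lipschitz is the same for the supremum distance
and for the Euclidean distance on `Δⁿ ⊆ ℝⁿ⁺¹`.) -/
def lipschitzSing (X : Type) [MetricSpace X] :
    (TopCat.toSSet.obj (TopCat.of X)).Subcomplex where
  obj n := {s | ∃ K, LipschitzWith K
    (fun p : stdSimplex ℝ (Fin (n.unop.len + 1)) =>
      ((TopCat.toSSetObjEquiv (TopCat.of X) n s) p : X))}
  map {m n} f s := by
    rintro ⟨K, hK⟩
    obtain ⟨K', hK'⟩ := exists_lipschitzWith_map f.unop.toOrderHom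
    exact ⟨K * K', hK.comp hK'⟩

/-- The first singular Lipschitz homology group with integral coefficients: the homology of the
complex of integral chains on Lipschitz simplices. -/
abbrev H1L (X : Type) [MetricSpace X] : AddCommGrpCat.{0} :=
  (lipschitzSing X).toSSet.homology (AddCommGrpCat.of ℤ) 1

/-- The comparison homomorphism from singular Lipschitz homology to singular homology, induced by
the inclusion of Lipschitz chains into all singular chains. -/
def comparison (X : Type) [MetricSpace X] : H1L X →+ H1 X :=
  (SSet.homologyMap (lipschitzSing X).ι (AddCommGrpCat.of ℤ) 1).hom

/-- The homology class of a `1`-simplex whose two end points agree. -/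
def edgeClass (S : SSet.{0}) (x : S _⦋1⦌) (hx : S.δ 0 x = S.δ 1 x) :
    ↑(S.homology (AddCommGrpCat.of ℤ) 1) :=
  ((S.chainComplex (AddCommGrpCat.of ℤ)).liftCycles (S.ιChainComplex x) 0 (by simp)
      (by simp [Fin.sum_univ_two, hx]) ≫
    (S.chainComplex (AddCommGrpCat.of ℤ)).homologyπ 1).hom (1 : ℤ)

/-! ### Lipschitz loops -/

/-- The restriction of `γ` to `[0, a]` is a Lipschitz loop based at `x₀`. -/
structure IsLipschitzLoop {X : Type} [MetricSpace X] (x₀ : X) (a : ℝ) (γ : ℝ → X) : Prop where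
  nonneg : 0 ≤ a
  lipschitz : ∃ K, LipschitzOnWith K γ (Set.Icc 0 a)
  source : γ 0 = x₀
  target : γ a = x₀

namespace IsLipschitzLoop

variable {X : Type} [MetricSpace X] {x₀ : X} {a : ℝ} {γ : ℝ → X}

theorem exists_lipschitzWith (h : IsLipschitzLoop x₀ a γ) :
    ∃ K, LipschitzWith K (fun t : Set.Icc (0 : ℝ) 1 => γ (a * t)) := by
  obtain ⟨K, hK⟩ := h.lipschitz
  have h1 : LipschitzWith a.toNNReal (fun t : Set.Icc (0 : ℝ) 1 => a * (t : ℝ)) := by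
    refine LipschitzWith.of_dist_le_mul fun s t => ?_
    rw [Real.dist_eq, ← mul_sub, abs_mul, abs_of_nonneg h.nonneg, Real.coe_toNNReal a h.nonneg]
    exact le_of_eq rfl
  refine ⟨K * a.toNNReal, fun s t => ?_⟩
  have hmem : ∀ t : Set.Icc (0 : ℝ) 1, a * (t : ℝ) ∈ Set.Icc 0 a := fun t =>
    ⟨mul_nonneg h.nonneg t.2.1, mul_le_of_le_one_right h.nonneg t.2.2⟩
  refine (hK (hmem s) (hmem t)).trans ?_
  rw [ENNReal.coe_mul, mul_assoc]
  gcongr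
  exact h1 s t

/-- The loop, reparametrized linearly over `[0, 1]`, as a path in the sense of Mathlib. -/
def toPath (h : IsLipschitzLoop x₀ a γ) : Path x₀ x₀ where
  toFun t := γ (a * t)
  continuous_toFun := h.exists_lipschitzWith.choose_spec.continuous
  source' := by simpa using h.source
  target' := by simpa using h.target

/-- The class of the loop in the fundamental group. -/
def pi1Class (h : IsLipschitzLoop x₀ a γ) : FundamentalGroup X x₀ :=
  FundamentalGroup.fromPath (Path.Homotopic.Quotient.mk h.toPath)

theorem exists_lipschitzWith_simplex (h : IsLipschitzLoop x₀ a γ) :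
    ∃ K, LipschitzWith K (fun p : stdSimplex ℝ (Fin 2) => γ (a * p 1)) := by
  obtain ⟨K, hK⟩ := h.exists_lipschitzWith
  have h1 : LipschitzWith 1 (fun p : stdSimplex ℝ (Fin 2) =>
      (⟨p 1, stdSimplex.zero_le p 1, stdSimplex.le_one p 1⟩ : Set.Icc (0 : ℝ) 1)) := by
    refine LipschitzWith.of_dist_le_mul fun p q => ?_
    rw [NNReal.coe_one, one_mul]
    exact dist_le_pi_dist (p : Fin 2 → ℝ) q 1
  exact ⟨K * 1, hK.comp h1⟩

/-- The loop, reparametrized linearly, as the Lipschitz `1`-simplex `(s₀, s₁) ↦ γ (a s₁)`. -/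
def toSimplex (h : IsLipschitzLoop x₀ a γ) : (lipschitzSing X).toSSet _⦋1⦌ :=
  ⟨(TopCat.toSSetObjEquiv (TopCat.of X) (Opposite.op ⦋1⦌)).symm
      ⟨fun p : stdSimplex ℝ (Fin 2) => γ (a * p 1),
        h.exists_lipschitzWith_simplex.choose_spec.continuous⟩, by
    obtain ⟨K, hK⟩ := h.exists_lipschitzWith_simplex
    refine ⟨K, ?_⟩
    rw [Equiv.apply_symm_apply]
    exact hK⟩

theorem δ_toSimplex (h : IsLipschitzLoop x₀ a γ) :
    (lipschitzSing X).toSSet.δ 0 h.toSimplex = (lipschitzSing X).toSSet.δ 1 h.toSimplex := by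
  have key : ∀ (i : Fin 2) (p : stdSimplex ℝ (Fin 1)),
      (TopCat.toSSetObjEquiv (TopCat.of X) (Opposite.op ⦋0⦌)
        ((lipschitzSing X).toSSet.δ i h.toSimplex).1) p =
        γ (a * stdSimplex.map (S := ℝ) i.succAbove p 1) := fun _ _ => rfl
  refine Subtype.ext ((TopCat.toSSetObjEquiv (TopCat.of X) (Opposite.op ⦋0⦌)).injective ?_)
  refine ContinuousMap.ext fun (p : stdSimplex ℝ (Fin 1)) => ?_
  have hp : p = stdSimplex.vertex 0 := Subsingleton.elim _ _
  refine (key 0 p).trans (Eq.trans ?_ (key 1 p).symm)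
  rw [hp, stdSimplex.map_vertex, stdSimplex.map_vertex]
  simp [h.source, h.target]

/-- The class of the loop in the first singular Lipschitz homology group. -/
def h1LClass (h : IsLipschitzLoop x₀ a γ) : H1L X :=
  edgeClass (lipschitzSing X).toSSet h.toSimplex h.δ_toSimplex

end IsLipschitzLoop

end

/-! ### The Hawaiian earring -/

/-- The circle in the plane with centre `(1/n, 0)` and radius `1/n`. -/
def circle (n : ℕ) : Set (EuclideanSpace ℝ (Fin 2)) :=
  Metric.sphere !₂[1 / (n : ℝ), 0] (1 / (n : ℝ))

/-- The Hawaiian earring, the union of the circles `circle n`, `n ≥ 1`. -/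
@[ext]
structure Hawaiian where
  point : EuclideanSpace ℝ (Fin 2)
  mem : ∃ n : ℕ, 1 ≤ n ∧ point ∈ circle n

theorem mem_circle_iff (n : ℕ) (x : EuclideanSpace ℝ (Fin 2)) :
    x ∈ circle n ↔ ‖x‖ ^ 2 = 2 * x 0 / n := by
  have h0 : (0 : ℝ) ≤ 1 / (n : ℝ) := by positivity
  rw [circle, mem_sphere_iff_norm, ← sq_eq_sq₀ (norm_nonneg _) h0, EuclideanSpace.norm_sq_eq,
    EuclideanSpace.norm_sq_eq]
  simp only [Fin.sum_univ_two, Real.norm_eq_abs, sq_abs, PiLp.sub_apply]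
  simp
  constructor <;> intro h
  · linear_combination h
  · linear_combination h

/-- Two different circles meet in the origin only. -/
theorem eq_zero_of_mem_circle {m n : ℕ} (hm : 1 ≤ m) (hn : 1 ≤ n) (hmn : m ≠ n)
    {x : EuclideanSpace ℝ (Fin 2)} (h1 : x ∈ circle m) (h2 : x ∈ circle n) : x = 0 := by
  rw [mem_circle_iff] at h1 h2
  have hm' : (m : ℝ) ≠ 0 := by positivity
  have hn' : (n : ℝ) ≠ 0 := by positivity
  have hmn' : (m : ℝ) - n ≠ 0 := sub_ne_zero.2 (by exact_mod_cast hmn)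
  have h3 : ((m : ℝ) - n) * ‖x‖ ^ 2 = 0 := by
    have e1 : (m : ℝ) * ‖x‖ ^ 2 = 2 * x 0 := by rw [h1]; field_simp
    have e2 : (n : ℝ) * ‖x‖ ^ 2 = 2 * x 0 := by rw [h2]; field_simp
    linear_combination e1 - e2
  simpa [hmn'] using h3

namespace Hawaiian

/-- Two points lie on a common circle of the Hawaiian earring. -/
def SameCircle (x y : Hawaiian) : Prop :=
  ∃ n : ℕ, 1 ≤ n ∧ x.point ∈ circle n ∧ y.point ∈ circle n

open Classical in
/-- The distance is the Euclidean one for points on a common circle, and `‖x‖ + ‖y‖` otherwise. -/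
instance : Dist Hawaiian where
  dist x y := if SameCircle x y then ‖x.point - y.point‖ else ‖x.point‖ + ‖y.point‖

theorem dist_of_same {x y : Hawaiian} (h : SameCircle x y) :
    dist x y = ‖x.point - y.point‖ := if_pos h

theorem dist_of_not_same {x y : Hawaiian} (h : ¬ SameCircle x y) :
    dist x y = ‖x.point‖ + ‖y.point‖ := if_neg h

theorem norm_sub_le_dist (x y : Hawaiian) : ‖x.point - y.point‖ ≤ dist x y := by
  by_cases h : SameCircle x y
  · rw [dist_of_same h]
  · rw [dist_of_not_same h]
    exact norm_sub_le _ _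

theorem dist_le_add (x y : Hawaiian) : dist x y ≤ ‖x.point‖ + ‖y.point‖ := by
  by_cases h : SameCircle x y
  · rw [dist_of_same h]
    exact norm_sub_le _ _
  · rw [dist_of_not_same h]

theorem SameCircle.symm {x y : Hawaiian} (h : SameCircle x y) : SameCircle y x := by
  obtain ⟨n, hn, h1, h2⟩ := h
  exact ⟨n, hn, h2, h1⟩

theorem SameCircle.refl (x : Hawaiian) : SameCircle x x := by
  obtain ⟨n, hn, h⟩ := x.mem
  exact ⟨n, hn, h, h⟩

instance : MetricSpace Hawaiian where
  dist_self x := by rw [dist_of_same (SameCircle.refl x)]; simp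
  dist_comm x y := by
    by_cases h : SameCircle x y
    · rw [dist_of_same h, dist_of_same h.symm, norm_sub_rev]
    · rw [dist_of_not_same h, dist_of_not_same (fun h' => h h'.symm), add_comm]
  dist_triangle x y z := by
    have h1 := norm_le_norm_add_norm_sub' x.point y.point
    have h2 := norm_le_norm_add_norm_sub' z.point y.point
    have h3 := dist_le_add x z
    have h4 := norm_nonneg y.point
    have h5 := norm_sub_rev z.point y.point
    by_cases hxy : SameCircle x y
    · by_cases hyz : SameCircle y z
      · by_cases hy : y.point = 0
        · rw [dist_of_same hxy, dist_of_same hyz]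
          linarith [norm_eq_zero.2 hy]
        · obtain ⟨m, hm, hx, hy1⟩ := hxy
          obtain ⟨n, hn, hy2, hz⟩ := hyz
          have hmn : m = n := by
            by_contra hne
            exact hy (eq_zero_of_mem_circle hm hn hne hy1 hy2)
          subst hmn
          rw [dist_of_same ⟨m, hm, hx, hz⟩]
          have h6 := norm_sub_le_norm_sub_add_norm_sub x.point y.point z.point
          linarith [norm_sub_le_dist x y, norm_sub_le_dist y z]
      · rw [dist_of_same hxy, dist_of_not_same hyz]
        linarith
    · rw [dist_of_not_same hxy]
      linarith [norm_sub_le_dist y z]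
  eq_of_dist_eq_zero {x y} h := by
    have h1 := norm_sub_le_dist x y
    rw [h] at h1
    exact Hawaiian.ext (sub_eq_zero.1 (norm_le_zero_iff.1 h1))

/-- The origin, the common point of all circles. -/
def origin : Hawaiian := ⟨0, 1, le_rfl, by simp [mem_circle_iff]⟩

end Hawaiian

/-! ### The loops -/

/-- The loop `[0, 1] → ℍ` which traverses the `n`-th circle with constant speed, `n ≥ 1`. -/
def phi (n : ℕ) (t : ℝ) : Hawaiian where
  point := !₂[-(Real.cos (2 * Real.pi * t) / n) + 1 / n, Real.sin (2 * Real.pi * t) / n]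
  mem := by
    rcases Nat.eq_zero_or_pos n with rfl | hn
    · exact ⟨1, le_rfl, by simp [mem_circle_iff, EuclideanSpace.norm_sq_eq]⟩
    · refine ⟨n, hn, ?_⟩
      have hn' : (n : ℝ) ≠ 0 := by positivity
      rw [mem_circle_iff, EuclideanSpace.norm_sq_eq]
      simp only [Fin.sum_univ_two, Real.norm_eq_abs, sq_abs]
      simp
      field_simp
      linear_combination Real.sin_sq_add_cos_sq (2 * Real.pi * t)

/-- The weights `λ(n) = 1 / (2ⁿ n!)`. -/
def lam (n : ℕ) : ℝ := 1 / (2 ^ n * (n.factorial : ℝ))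

/-- The non-empty finite sequences `⟨s(1), …, s(n)⟩` of natural numbers with `1 ≤ s(i) ≤ i` for
all `i`. Lists of natural numbers carry the lexicographic order, in which a proper initial segment
of a sequence is smaller than the sequence. -/
def seqB : Set (List ℕ) :=
  {s | s ≠ [] ∧ ∀ (i : ℕ) (hi : i < s.length), 1 ≤ s[i] ∧ s[i] ≤ i + 1}

/-- `τ(s)` is the sum of `λ(ℓ(t))` over all `t ∈ seqB` that precede `s` in the lexicographic order,
where `ℓ(t)` denotes the length of `t`. -/
def tau (s : List ℕ) : ℝ := ∑' t : {t : List ℕ // t ∈ seqB ∧ t < s}, lam t.1.length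

/-- The sequences `(n_k)_{k ≥ 1}` of positive integers with `4 · 2π / n_k ≤ λ(k)` and
`n_{k+1} > n_k + 1`, which select the circles used by the loops. -/
def Admissible (N : ℕ → ℕ) : Prop :=
  ∀ k : ℕ, 1 ≤ k → 1 ≤ N k ∧ 4 * (2 * Real.pi / (N k : ℝ)) ≤ lam k ∧ N k + 1 < N (k + 1)

/-- The concatenation `φ_m · φ_n · φ_m⁻¹ · φ_n⁻¹` on `[0, 4]`. -/
def commutatorLoop (m n : ℕ) (u : ℝ) : Hawaiian :=
  if u ≤ 1 then phi m u
  else if u ≤ 2 then phi n (u - 1)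
  else if u ≤ 3 then phi m (1 - (u - 2))
  else phi n (1 - (u - 3))

/-- The commutator of the loops `φ_{n_k}` and `φ_{n_k + 1}`, parametrized over `[0, λ(k)]`. -/
def cLoop (N : ℕ → ℕ) (k : ℕ) (t : ℝ) : Hawaiian :=
  commutatorLoop (N k) (N k + 1) (4 * t / lam k)

/-- `σ` is `1`-Lipschitz and runs through `c_{ℓ(s)}` on `[τ(s), τ(s + ⟨1⟩)]` for all `s ∈ seqB`. -/
def IsSigmaOne (N : ℕ → ℕ) (σ : Set.Icc (0 : ℝ) 1 → Hawaiian) : Prop :=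
  LipschitzWith 1 σ ∧ ∀ s ∈ seqB, ∀ t : Set.Icc (0 : ℝ) 1,
    tau s ≤ t → (t : ℝ) ≤ tau (s ++ [1]) → σ t = cLoop N s.length (t - tau s)

/-- The map `σ_n`, considered on `[0, 2λ(n)]`, given by `σ_n(t) = σ_1(t + τ(⟨1, …, 1⟩))`, where
`⟨1, …, 1⟩` has length `n ≥ 1`. (For `0 ≤ t ≤ 2λ(n)` the argument of `σ_1` lies in `[0, 1]`, and
for `n = 1` this is `σ_1`.) -/
def sigma (σ : Set.Icc (0 : ℝ) 1 → Hawaiian) (n : ℕ) (t : ℝ) : Hawaiian :=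
  Set.IccExtend zero_le_one σ (t + tau (List.replicate n 1))

end HawaiianEarring

end

open HawaiianEarring

noncomputable section

namespace HawaiianEarring

/-! ### Edges in the chain complex of a simplicial set -/

section

open CategoryTheory Simplicial

/-! The block of a sequence of length `n` is an interval of length `2 * lam n`: its first half is
filled by the commutator loop of level `n`, and by the identity `(n + 1) * (2 * lam (n + 1)) = lam
n` its second half consists of exactly `n + 1` blocks of level `n + 1`. All blocks of one level
carry the same loop, so `σ_n` is the commutator `c_n` followed by `n + 1` copies of `σ_{n+1}`
(`LoopInvariant.val_sigma`). In Lipschitz homology the commutator dies, so `[σ_n] = (n + 1)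
[σ_{n+1}]`, and the classes of such a tower generate a divisible subgroup.

For nontriviality, a pair of circles `p ≠ q` defines a map from the earring to the Heisenberg
nilmanifold, and lifting loops gives a homomorphism `heisHom` from the fundamental group to the
Heisenberg group. Its first two coordinates are winding numbers; the third is a kind of enclosed
area. On a commutator of `x` and `y` the area is the determinant of the winding numbers of `x` and
`y` around `p` and `q`, so as a matrix indexed by pairs of circles it has rank at most two. Areas
add on the commutator subgroup, because winding numbers vanish there; hence every element of it has
an area matrix of finite rank. For `σ₁`, the matrix with rows `p = N i` and columns `q = N j + 1` is
diagonal with nonzero diagonal entries, so its rank is infinite and `σ₁` is not in the commutator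
subgroup.

Finally, sending a singular edge to the class of the loop obtained by joining its end points to the
base point is additive on triangles, which gives a homomorphism from `H1` to the abelianized
fundamental group. It detects the image of `[σ₁]` in singular homology, and homomorphic images of
divisible subgroups are divisible. -/

theorem edgeClass_congr {S : SSet.{0}} {x y : S _⦋1⦌} (h : x = y) (hx : S.δ 0 x = S.δ 1 x)
    (hy : S.δ 0 y = S.δ 1 y) : edgeClass S x hx = edgeClass S y hy := by
  subst h; rfl

theorem edgeClass_add (S : SSet.{0}) (y : S _⦋2⦌) (h0 : S.δ 0 (S.δ 0 y) = S.δ 1 (S.δ 0 y))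
    (h1 : S.δ 0 (S.δ 1 y) = S.δ 1 (S.δ 1 y)) (h2 : S.δ 0 (S.δ 2 y) = S.δ 1 (S.δ 2 y)) :
    edgeClass S (S.δ 1 y) h1 = edgeClass S (S.δ 2 y) h2 + edgeClass S (S.δ 0 y) h0 := by
  let K := S.chainComplex (AddCommGrpCat.of ℤ)
  have hz : ∀ (x : S _⦋1⦌) (hx : S.δ 0 x = S.δ 1 x), S.ιChainComplex x ≫ K.d 1 0 = 0 := by
    intro x hx
    simp [K, Fin.sum_univ_two, hx]
  -- The alternating sum of the faces is the boundary of `y`, hence zero in homology.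
  have e : K.liftCycles (S.ιChainComplex (S.δ 2 y)) 0 (by simp) (hz _ h2)
      + K.liftCycles (S.ιChainComplex (S.δ 0 y)) 0 (by simp) (hz _ h0)
      - K.liftCycles (S.ιChainComplex (S.δ 1 y)) 0 (by simp) (hz _ h1)
      = S.ιChainComplex y ≫ K.toCycles 2 1 := by
    rw [← cancel_mono (K.iCycles 1)]
    simp [K, Fin.sum_univ_three]
    abel
  have e2 := congrArg (fun f => (f ≫ K.homologyπ 1).hom (1 : ℤ)) e
  simp only [Preadditive.add_comp, Preadditive.sub_comp, Category.assoc,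
    HomologicalComplex.toCycles_comp_homologyπ, Limits.comp_zero] at e2
  symm
  rw [← sub_eq_zero]
  exact e2

theorem homologyMap_edgeClass {S T : SSet.{0}} (f : S ⟶ T) (x : S _⦋1⦌)
    (hx : S.δ 0 x = S.δ 1 x) (hx' : T.δ 0 (f.app _ x) = T.δ 1 (f.app _ x)) :
    (SSet.homologyMap f (AddCommGrpCat.of ℤ) 1).hom (edgeClass S x hx) =
      edgeClass T (f.app _ x) hx' := by
  let K := S.chainComplex (AddCommGrpCat.of ℤ)
  let L := T.chainComplex (AddCommGrpCat.of ℤ)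
  have hz : S.ιChainComplex x ≫ K.d 1 0 = 0 := by simp [K, Fin.sum_univ_two, hx]
  have hz' : T.ιChainComplex (f.app _ x) ≫ L.d 1 0 = 0 := by simp [L, Fin.sum_univ_two, hx']
  have e : (K.liftCycles (S.ιChainComplex x) 0 (by simp) hz ≫ K.homologyπ 1) ≫
      SSet.homologyMap f (AddCommGrpCat.of ℤ) 1 =
      L.liftCycles (T.ιChainComplex (f.app _ x)) 0 (by simp) hz' ≫ L.homologyπ 1 := by
    rw [Category.assoc, HomologicalComplex.homologyπ_naturality, ← Category.assoc]
    congr 1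
    rw [← cancel_mono (L.iCycles 1)]
    simp [K, L]
  exact congrArg (fun f => f.hom (1 : ℤ)) e

/-- A function on edges that is additive on triangles extends to first homology. -/
theorem exists_hom_edgeClass (S : SSet.{0}) {A : Type} [AddCommGroup A] (w : S _⦋1⦌ → A)
    (hw : ∀ y : S _⦋2⦌, w (S.δ 1 y) = w (S.δ 2 y) + w (S.δ 0 y)) :
    ∃ F : ↑(S.homology (AddCommGrpCat.of ℤ) 1) →+ A, ∀ x hx, F (edgeClass S x hx) = w x := by
  let K := S.chainComplex (AddCommGrpCat.of ℤ)
  let g : K.X 1 ⟶ AddCommGrpCat.of A :=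
    Limits.Cofan.IsColimit.desc (S.isColimitChainComplexXCofan (AddCommGrpCat.of ℤ) 1)
      fun x => AddCommGrpCat.ofHom (zmultiplesHom A (w x))
  have hg : ∀ x, S.ιChainComplex x ≫ g = AddCommGrpCat.ofHom (zmultiplesHom A (w x)) := fun x =>
    Limits.Cofan.IsColimit.fac (S.isColimitChainComplexXCofan (AddCommGrpCat.of ℤ) 1) _ x
  have hd : K.d 2 1 ≫ g = 0 := by
    apply SSet.chainComplex_hom_ext
    intro y
    have e : S.ιChainComplex y ≫ K.d 2 1 = S.ιChainComplex (S.δ 0 y) - S.ιChainComplex (S.δ 1 y)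
        + S.ιChainComplex (S.δ 2 y) := by
      simp [K, Fin.sum_univ_three]
      abel
    rw [← Category.assoc, e]
    simp only [Preadditive.add_comp, Preadditive.sub_comp, hg]
    ext
    simp [hw]
  -- The cochain `g` kills boundaries, so it factors through the opcycles, into which homology
  -- embeds. The extension need not be specified on edges that are not cycles.
  refine ⟨(K.homologyι 1 ≫ K.descOpcycles g 2 (by simp) hd).hom, fun x hx => ?_⟩
  have hz : S.ιChainComplex x ≫ K.d 1 0 = 0 := by simp [K, Fin.sum_univ_two, hx]
  have e : (K.liftCycles (S.ιChainComplex x) 0 (by simp) hz ≫ K.homologyπ 1) ≫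
      K.homologyι 1 ≫ K.descOpcycles g 2 (by simp) hd =
      AddCommGrpCat.ofHom (zmultiplesHom A (w x)) := by
    simp [hg]
  exact (congrArg (fun f => f.hom (1 : ℤ)) e).trans (one_zsmul (w x))

end

/-! ### From first homology to the abelianized fundamental group -/

section

open CategoryTheory Simplicial

variable {X : Type} [TopologicalSpace X]

/-- Two paths in a simply connected space compose, up to homotopy, to any third path that closes
the triangle; this persists after applying a continuous map. -/
theorem mk_map_trans {E : Type*} [TopologicalSpace E] [SimplyConnectedSpace E] (f : C(E, X))
    {a b c : E} (P : Path a b) (Q : Path b c) (R : Path a c) :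
    (Path.Homotopic.Quotient.mk (P.map f.continuous)).trans (Path.Homotopic.Quotient.mk (Q.map f.continuous)) =
      Path.Homotopic.Quotient.mk (R.map f.continuous) := by
  rw [← Path.Homotopic.Quotient.mk_trans, ← Path.map_trans]
  exact Path.Homotopic.Quotient.eq.2 ((SimplyConnectedSpace.paths_homotopic (P.trans Q) R).map f)

theorem cast_trans {a b c a' b' c' : X} (p : Path.Homotopic.Quotient a b)
    (q : Path.Homotopic.Quotient b c) (ha : a' = a) (hb : b' = b) (hc : c' = c) :
    (p.trans q).cast ha hc = (p.cast ha hb).trans (q.cast hb hc) := by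
  subst ha hb hc
  simp only [Path.Homotopic.Quotient.cast_rfl_rfl]

variable [PathConnectedSpace X] (x₀ : X)

/-- The class of a path in the abelianized fundamental group, after connecting its end points
to the base point. -/
def abClass {a b : X} (γ : Path a b) : Abelianization (FundamentalGroup X x₀) :=
  Abelianization.of (FundamentalGroup.fromPath
    (((Path.Homotopic.Quotient.mk (PathConnectedSpace.somePath x₀ a)).trans (Path.Homotopic.Quotient.mk γ)).trans
      (Path.Homotopic.Quotient.mk (PathConnectedSpace.somePath x₀ b)).symm))

theorem abClass_congr {a b a' b' : X} {γ : Path a b} {γ' : Path a' b'} (h : ∀ t, γ t = γ' t) :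
    abClass x₀ γ = abClass x₀ γ' := by
  obtain rfl : a = a' := by simpa using h 0
  obtain rfl : b = b' := by simpa using h 1
  congr
  ext t
  exact h t

/-- The two connecting paths at the middle point `b` cancel. Multiplication in `FundamentalGroup` is
concatenation in reversed order; the commutativity of the target absorbs the reversal. -/
theorem abClass_trans {a b c : X} {γ : Path a b} {γ' : Path b c} {γ'' : Path a c}
    (h : (Path.Homotopic.Quotient.mk γ).trans (Path.Homotopic.Quotient.mk γ') = Path.Homotopic.Quotient.mk γ'') :
    abClass x₀ γ'' = abClass x₀ γ * abClass x₀ γ' := by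
  rw [mul_comm, abClass, abClass, abClass, ← map_mul, ← h]
  congr 1
  rw [FundamentalGroup.mul_def]
  simp only [Path.Homotopic.Quotient.trans_assoc]
  congr 2
  rw [← Path.Homotopic.Quotient.trans_assoc (Path.Homotopic.Quotient.symm _), Path.Homotopic.Quotient.symm_trans, Path.Homotopic.Quotient.refl_trans]

/-- The connecting path from `x₀` to itself is some loop, not necessarily the constant one; it
contributes a conjugation, which is invisible in the abelianization. -/
theorem abClass_loop (γ : Path x₀ x₀) :
    abClass x₀ γ = Abelianization.of (FundamentalGroup.fromPath (Path.Homotopic.Quotient.mk γ)) := by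
  have e : FundamentalGroup.fromPath
      (((Path.Homotopic.Quotient.mk (PathConnectedSpace.somePath x₀ x₀)).trans (Path.Homotopic.Quotient.mk γ)).trans
        (Path.Homotopic.Quotient.mk (PathConnectedSpace.somePath x₀ x₀)).symm) =
      (FundamentalGroup.fromPath (Path.Homotopic.Quotient.mk (PathConnectedSpace.somePath x₀ x₀)))⁻¹ *
        (FundamentalGroup.fromPath (Path.Homotopic.Quotient.mk γ) *
        FundamentalGroup.fromPath (Path.Homotopic.Quotient.mk (PathConnectedSpace.somePath x₀ x₀))) := rfl
  rw [abClass, e, map_mul, map_mul, map_inv, mul_comm, mul_assoc, mul_inv_cancel, mul_one]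

/-- The edge of the standard simplex from one vertex to another one. -/
def simplexEdge : Path (stdSimplex.vertex (S := ℝ) (0 : Fin 2)) (stdSimplex.vertex 1) where
  toFun t := stdSimplexHomeomorphUnitInterval.symm t
  continuous_toFun := stdSimplexHomeomorphUnitInterval.symm.continuous
  source' := by
    rw [Homeomorph.symm_apply_eq]
    rfl
  target' := by
    rw [Homeomorph.symm_apply_eq]
    rfl

theorem simplexEdge_apply_one (t : unitInterval) : simplexEdge t 1 = t := by
  have := stdSimplexHomeomorphUnitInterval.apply_symm_apply t
  exact congrArg Subtype.val this

/-- The map of the standard simplex that corresponds to a singular simplex. -/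
abbrev simplexMap {X : Type} [TopologicalSpace X] {n : ℕ}
    (x : (TopCat.toSSet.obj (TopCat.of X)) _⦋n⦌) : C(stdSimplex ℝ (Fin (n + 1)), X) :=
  TopCat.toSSetObjEquiv (TopCat.of X) (Opposite.op ⦋n⦌) x

instance (n : ℕ) : ContractibleSpace (stdSimplex ℝ (Fin (n + 1))) :=
  (convex_stdSimplex ℝ (Fin (n + 1))).contractibleSpace
    ⟨_, (stdSimplex.vertex (S := ℝ) (0 : Fin (n + 1))).2⟩

/-- The face of the standard `2`-simplex opposite to a vertex, as a path. -/
def faceEdge (i : Fin 3) {j k : Fin 3} (hj : i.succAbove 0 = j) (hk : i.succAbove 1 = k) :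
    Path (stdSimplex.vertex (S := ℝ) j) (stdSimplex.vertex k) :=
  (simplexEdge.map (stdSimplex.continuous_map i.succAbove)).cast
    (by rw [stdSimplex.map_vertex, hj]) (by rw [stdSimplex.map_vertex, hk])

/-- A homomorphism from first homology to the abelianized fundamental group, which is the obvious
one on loops. -/
theorem exists_hom_abelianization :
    ∃ F : H1 X →+ Additive (Abelianization (FundamentalGroup X x₀)),
      ∀ x hx, F (edgeClass (TopCat.toSSet.obj (TopCat.of X)) x hx) =
        Additive.ofMul (abClass x₀ (simplexEdge.map (simplexMap x).continuous)) := by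
  refine exists_hom_edgeClass (TopCat.toSSet.obj (TopCat.of X)) (fun x =>
    Additive.ofMul (abClass x₀ (simplexEdge.map (simplexMap x).continuous))) fun y => ?_
  rw [← ofMul_mul]
  congr 1
  -- The three faces are paths in the simply connected `2`-simplex, so the first two compose to the
  -- third up to homotopy.
  have h := abClass_trans x₀ (mk_map_trans (simplexMap y)
    (faceEdge 2 (j := 0) (k := 1) rfl rfl) (faceEdge 0 (j := 1) (k := 2) rfl rfl)
    (faceEdge 1 (j := 0) (k := 2) rfl rfl))
  refine Eq.trans ?_ (h.trans ?_)
  · exact abClass_congr x₀ fun t => rfl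
  · congr 1 <;> exact abClass_congr x₀ fun t => rfl

end

/-! ### Invariants of Lipschitz loops -/

section

open CategoryTheory Simplicial

variable {X : Type} [MetricSpace X] {x₀ : X}

/-- Loops are cut out of one Lipschitz map on the whole line, between any two parameters in the
fibre of `x₀`. The order of `x` and `y` is free, so constant loops (`x = y`) and inverse loops (`y <
x`) are covered by the same concatenation rule. -/
theorem isLipschitzLoop_affine {K : NNReal} {g : ℝ → X} (hg : LipschitzWith K g) {x y : ℝ}
    (hx : g x = x₀) (hy : g y = x₀) :
    IsLipschitzLoop x₀ 1 (fun t => g (x + (y - x) * t)) where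
  nonneg := zero_le_one
  lipschitz := by
    have h : LipschitzWith (Real.nnabs (y - x)) (fun t : ℝ => x + (y - x) * t) := by
      refine LipschitzWith.of_dist_le_mul fun s t => ?_
      rw [Real.dist_eq, Real.dist_eq, add_sub_add_left_eq_sub, ← mul_sub, abs_mul]
      rfl
    exact ⟨_, (hg.comp h).lipschitzOnWith⟩
  source := by simpa using hx
  target := by simpa using hy

/-- A function on Lipschitz loops with values in a group that only depends on the linear
reparametrization over `[0, 1]` and turns concatenation into (reversed) multiplication. -/
structure LoopInvariant (x₀ : X) (A : Type*) [Group A] where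
  val : ∀ {a : ℝ} {γ : ℝ → X}, IsLipschitzLoop x₀ a γ → A
  congr : ∀ {a b : ℝ} {γ η : ℝ → X} (h : IsLipschitzLoop x₀ a γ) (h' : IsLipschitzLoop x₀ b η),
    (∀ t ∈ Set.Icc (0 : ℝ) 1, γ (a * t) = η (b * t)) → val h = val h'
  trans : ∀ {K : NNReal} {g : ℝ → X} (hg : LipschitzWith K g) {x y z : ℝ}
    (hx : g x = x₀) (hy : g y = x₀) (hz : g z = x₀),
    val (isLipschitzLoop_affine hg hx hz) =
      val (isLipschitzLoop_affine hg hy hz) * val (isLipschitzLoop_affine hg hx hy)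

namespace IsLipschitzLoop

variable {a b : ℝ} {γ η : ℝ → X}

theorem toSimplex_congr (h : IsLipschitzLoop x₀ a γ) (h' : IsLipschitzLoop x₀ b η)
    (e : ∀ t ∈ Set.Icc (0 : ℝ) 1, γ (a * t) = η (b * t)) : h.toSimplex = h'.toSimplex := by
  refine Subtype.ext ((TopCat.toSSetObjEquiv (TopCat.of X) (Opposite.op ⦋1⦌)).symm.injective.eq_iff.2
    (ContinuousMap.ext fun (p : stdSimplex ℝ (Fin 2)) => ?_))
  exact e (p 1) ⟨stdSimplex.zero_le p 1, stdSimplex.le_one p 1⟩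

theorem h1LClass_congr (h : IsLipschitzLoop x₀ a γ) (h' : IsLipschitzLoop x₀ b η)
    (e : ∀ t ∈ Set.Icc (0 : ℝ) 1, γ (a * t) = η (b * t)) : h.h1LClass = h'.h1LClass :=
  edgeClass_congr (toSimplex_congr h h' e) _ _

theorem pi1Class_congr (h : IsLipschitzLoop x₀ a γ) (h' : IsLipschitzLoop x₀ b η)
    (e : ∀ t ∈ Set.Icc (0 : ℝ) 1, γ (a * t) = η (b * t)) : h.pi1Class = h'.pi1Class := by
  have : h.toPath = h'.toPath := Path.ext (funext fun t => e t t.2)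
  rw [pi1Class, pi1Class, this]

/-- All three loops are images under `g` of segments in the line, which is simply connected; no
reparametrization of a concatenation is needed. -/
theorem pi1Class_trans {K : NNReal} {g : ℝ → X} (hg : LipschitzWith K g) {x y z : ℝ}
    (hx : g x = x₀) (hy : g y = x₀) (hz : g z = x₀) :
    (isLipschitzLoop_affine hg hx hz).pi1Class =
      (isLipschitzLoop_affine hg hy hz).pi1Class * (isLipschitzLoop_affine hg hx hy).pi1Class := by
  have key : ∀ {x y : ℝ} (hx : g x = x₀) (hy : g y = x₀),
      (isLipschitzLoop_affine hg hx hy).pi1Class = FundamentalGroup.fromPath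
        ((Path.Homotopic.Quotient.mk ((Path.segment x y).map hg.continuous)).cast
          hx.symm hy.symm) := by
    intro x y hx hy
    rw [pi1Class, ← Path.Homotopic.Quotient.mk_cast]
    congr 2
    ext t
    simp [toPath, AffineMap.lineMap_apply, add_comm, mul_comm]
  rw [key hx hz, key hy hz, key hx hy, FundamentalGroup.mul_def]
  have h := mk_map_trans ⟨g, hg.continuous⟩ (Path.segment x y) (Path.segment y z)
    (Path.segment x z)
  simp only [ContinuousMap.coe_mk] at h
  rw [← h]
  exact cast_trans _ _ hx.symm hy.symm hz.symm

/-- The affine singular `2`-simplex in the line with given vertices, mapped by a Lipschitz map. -/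
def triangle {K : NNReal} {g : ℝ → X} (hg : LipschitzWith K g) (x y z : ℝ) :
    (lipschitzSing X).toSSet _⦋2⦌ :=
  ⟨(TopCat.toSSetObjEquiv (TopCat.of X) (Opposite.op ⦋2⦌)).symm
      ⟨fun p : stdSimplex ℝ (Fin 3) => g (x * p 0 + y * p 1 + z * p 2),
        hg.continuous.comp (by
          have h : ∀ i, Continuous fun p : stdSimplex ℝ (Fin 3) => p i := fun i =>
            (continuous_apply i).comp continuous_subtype_val
          exact ((continuous_const.mul (h 0)).add (continuous_const.mul (h 1))).add
            (continuous_const.mul (h 2)))⟩, by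
    have h1 : ∀ (c : ℝ) (i : Fin 3), LipschitzWith (Real.nnabs c)
        (fun p : stdSimplex ℝ (Fin 3) => c * p i) := by
      intro c i
      refine LipschitzWith.of_dist_le_mul fun p q => ?_
      rw [Real.dist_eq, ← mul_sub, abs_mul]
      exact mul_le_mul_of_nonneg_left (dist_le_pi_dist (p : Fin 3 → ℝ) q i) (abs_nonneg c)
    refine ⟨K * (Real.nnabs x + Real.nnabs y + Real.nnabs z), ?_⟩
    rw [Equiv.apply_symm_apply]
    exact hg.comp (((h1 x 0).add (h1 y 1)).add (h1 z 2))⟩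

/-- The degenerate triangle in the line with vertices `x`, `y`, `z`, pushed forward by `g`, is a
Lipschitz `2`-simplex whose faces are the three loops. -/
theorem h1LClass_trans {K : NNReal} {g : ℝ → X} (hg : LipschitzWith K g) {x y z : ℝ}
    (hx : g x = x₀) (hy : g y = x₀) (hz : g z = x₀) :
    (isLipschitzLoop_affine hg hx hz).h1LClass =
      (isLipschitzLoop_affine hg hy hz).h1LClass + (isLipschitzLoop_affine hg hx hy).h1LClass := by
  have key : ∀ (i : Fin 3) {a b : ℝ} (ha : g a = x₀) (hb : g b = x₀),
      (∀ p : stdSimplex ℝ (Fin 2), x * stdSimplex.map (S := ℝ) i.succAbove p 0 +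
        y * stdSimplex.map (S := ℝ) i.succAbove p 1 + z * stdSimplex.map (S := ℝ) i.succAbove p 2
        = a * p 0 + b * p 1) →
      (isLipschitzLoop_affine hg ha hb).toSimplex =
        (lipschitzSing X).toSSet.δ i (triangle hg x y z) := by
    intro i a b ha hb e
    refine Subtype.ext ((TopCat.toSSetObjEquiv (TopCat.of X) (Opposite.op ⦋1⦌)).injective
      (ContinuousMap.ext fun (p : stdSimplex ℝ (Fin 2)) => ?_))
    refine Eq.trans (b := g (a + (b - a) * (1 * p 1))) ?_ (Eq.trans ?_ (Eq.refl
      (g (x * stdSimplex.map (S := ℝ) i.succAbove p 0 +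
        y * stdSimplex.map (S := ℝ) i.succAbove p 1 +
        z * stdSimplex.map (S := ℝ) i.succAbove p 2))))
    · rfl
    · rw [e]
      congr 1
      have : p 0 + p 1 = 1 := (Fin.sum_univ_two _).symm.trans (stdSimplex.sum_eq_one p)
      linear_combination a * (-this)
  have k0 := key 0 hy hz (fun p => by simp [stdSimplex.map_coe, FunOnFinite.linearMap_apply_apply,
    Fin.sum_univ_two, Finset.sum_filter])
  have k1 := key 1 hx hz (fun p => by simp [stdSimplex.map_coe, FunOnFinite.linearMap_apply_apply,
    Fin.sum_univ_two, Finset.sum_filter])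
  have k2 := key 2 hx hy (fun p => by
    have e : Fin.succAbove (2 : Fin 3) (1 : Fin 2) = 1 := rfl
    simp [stdSimplex.map_coe, FunOnFinite.linearMap_apply_apply, Fin.sum_univ_two,
      Finset.sum_filter, e])
  have l0 := (isLipschitzLoop_affine hg hy hz).δ_toSimplex
  have l1 := (isLipschitzLoop_affine hg hx hz).δ_toSimplex
  have l2 := (isLipschitzLoop_affine hg hx hy).δ_toSimplex
  rw [add_comm]
  rw [k0] at l0
  rw [k1] at l1
  rw [k2] at l2
  have h := edgeClass_add _ (triangle hg x y z) l0 l1 l2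
  rw [h1LClass, h1LClass, h1LClass, edgeClass_congr k0 _ l0, edgeClass_congr k1 _ l1,
    edgeClass_congr k2 _ l2, h]

/-- A Lipschitz loop whose class in the fundamental group is not a product of commutators
represents a nontrivial class in singular homology. -/
theorem comparison_h1LClass_ne_zero [PathConnectedSpace X] (h : IsLipschitzLoop x₀ a γ)
    (hc : h.pi1Class ∉ commutator (FundamentalGroup X x₀)) : comparison X h.h1LClass ≠ 0 := by
  intro h0
  obtain ⟨F, hF⟩ := exists_hom_abelianization (X := X) x₀
  have hx : (TopCat.toSSet.obj (TopCat.of X)).δ 0 h.toSimplex.1 =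
      (TopCat.toSSet.obj (TopCat.of X)).δ 1 h.toSimplex.1 := congrArg Subtype.val h.δ_toSimplex
  have e : comparison X h.h1LClass = edgeClass (TopCat.toSSet.obj (TopCat.of X)) h.toSimplex.1 hx :=
    homologyMap_edgeClass (lipschitzSing X).ι h.toSimplex h.δ_toSimplex hx
  rw [e] at h0
  have e1 := hF _ hx
  rw [h0, map_zero] at e1
  apply hc
  have e2 : abClass x₀ (simplexEdge.map (simplexMap h.toSimplex.1).continuous) =
      abClass x₀ h.toPath := by
    refine abClass_congr x₀ fun t => ?_
    have : (simplexEdge.map (simplexMap h.toSimplex.1).continuous) t = γ (a * simplexEdge t 1) := rfl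
    rw [this, simplexEdge_apply_one]
    rfl
  rw [e2, abClass_loop] at e1
  have e3 : Abelianization.of h.pi1Class = 1 := e1.symm
  rwa [← MonoidHom.mem_ker, Abelianization.ker_of] at e3

end IsLipschitzLoop

variable (x₀) in
/-- The class in Lipschitz homology as an invariant. -/
def h1LInvariant : LoopInvariant x₀ (Multiplicative (H1L X)) where
  val h := Multiplicative.ofAdd h.h1LClass
  congr h h' e := congrArg _ (h.h1LClass_congr h' e)
  trans hg _ _ _ hx hy hz := congrArg _ (IsLipschitzLoop.h1LClass_trans hg hx hy hz)

variable (x₀) in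
/-- The image of the class in the fundamental group under a homomorphism as an invariant. -/
def pi1Invariant {A : Type*} [Group A] (f : FundamentalGroup X x₀ →* A) : LoopInvariant x₀ A where
  val h := f h.pi1Class
  congr h h' e := congrArg _ (h.pi1Class_congr h' e)
  trans hg _ _ _ hx hy hz := by rw [IsLipschitzLoop.pi1Class_trans hg hx hy hz, map_mul]

end

/-! ### The combinatorics of the sequences -/

theorem lam_pos (n : ℕ) : 0 < lam n := by
  unfold lam
  positivity

theorem lam_zero : lam 0 = 1 := by simp [lam]

/-- This is what makes the construction close up: `n + 1` blocks of length `2 * lam (n + 1)` fill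
the second half of a block of length `2 * lam n`. -/
theorem lam_succ (n : ℕ) : (n + 1) * (2 * lam (n + 1)) = lam n := by
  rw [lam, lam, Nat.factorial_succ, pow_succ]
  push_cast
  field_simp

theorem lam_le (n : ℕ) : lam n ≤ (1 / 2) ^ n := by
  rw [lam, one_div_pow]
  refine one_div_le_one_div_of_le (by positivity) ?_
  exact le_mul_of_one_le_right (by positivity) (by exact_mod_cast n.factorial_pos)

/-- The sequences that can follow a sequence of length `n` inside a member of `seqB`. -/
def tailB (n : ℕ) : Set (List ℕ) :=
  {s | ∀ (i : ℕ) (hi : i < s.length), 1 ≤ s[i] ∧ s[i] ≤ n + i + 1}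

theorem nil_mem_tailB (n : ℕ) : [] ∈ tailB n := fun i hi => absurd hi (Nat.not_lt_zero i)

theorem cons_mem_tailB {n j : ℕ} {u : List ℕ} :
    j :: u ∈ tailB n ↔ (1 ≤ j ∧ j ≤ n + 1) ∧ u ∈ tailB (n + 1) := by
  constructor
  · refine fun h => ⟨h 0 (Nat.succ_pos _), fun i hi => ?_⟩
    have := h (i + 1) (Nat.succ_lt_succ hi)
    simp only [List.getElem_cons_succ] at this
    omega
  · rintro ⟨h1, h2⟩ (_ | i) hi
    · exact h1
    · have := h2 i (Nat.lt_of_succ_lt_succ hi)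
      simp only [List.getElem_cons_succ]
      omega

theorem append_mem_tailB {n : ℕ} {u v : List ℕ} :
    u ++ v ∈ tailB n ↔ u ∈ tailB n ∧ v ∈ tailB (n + u.length) := by
  induction u generalizing n with
  | nil => simp [nil_mem_tailB]
  | cons j u ih =>
    rw [List.cons_append, cons_mem_tailB, cons_mem_tailB, ih, List.length_cons, and_assoc,
      and_assoc, and_assoc, Nat.add_assoc n 1, Nat.add_comm 1]

theorem mem_seqB_iff {s : List ℕ} : s ∈ seqB ↔ s ≠ [] ∧ s ∈ tailB 0 := by
  simp only [seqB, tailB, zero_add]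
  rfl

/-- The members of `tailB n` of length `k`. -/
def tailFinset : ℕ → ℕ → Finset (List ℕ)
  | _, 0 => {[]}
  | n, k + 1 => (Finset.Icc 1 (n + 1) ×ˢ tailFinset (n + 1) k).image fun p => p.1 :: p.2

theorem mem_tailFinset {n k : ℕ} {u : List ℕ} :
    u ∈ tailFinset n k ↔ u ∈ tailB n ∧ u.length = k := by
  induction k generalizing n u with
  | zero =>
    rw [tailFinset, Finset.mem_singleton, List.length_eq_zero_iff]
    exact ⟨fun h => ⟨h ▸ nil_mem_tailB n, h⟩, fun h => h.2⟩
  | succ k ih =>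
    simp only [tailFinset, Finset.mem_image, Finset.mem_product, Finset.mem_Icc, Prod.exists, ih]
    cases u with
    | nil => simp
    | cons j u =>
      rw [cons_mem_tailB]
      constructor
      · rintro ⟨a, b, h, e⟩
        obtain ⟨rfl, rfl⟩ := List.cons_eq_cons.1 e
        exact ⟨⟨h.1, h.2.1⟩, by simp [h.2.2]⟩
      · intro h
        exact ⟨j, u, ⟨h.1.1, h.1.2, by simpa using h.2⟩, rfl⟩

/-- The `i`-th entry has `n + i` possible values, while passing from length `n + i - 1` to `n + i`
divides `lam` by `2 * (n + i)`. So each length carries half the weight of the preceding one. -/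
theorem card_tailFinset_mul_lam (n k : ℕ) :
    ((tailFinset n k).card : ℝ) * lam (n + k) = lam n * (1 / 2) ^ k := by
  induction k generalizing n with
  | zero => simp [tailFinset]
  | succ k ih =>
    have hinj : Function.Injective fun p : ℕ × List ℕ => p.1 :: p.2 := by
      rintro ⟨a, b⟩ ⟨c, d⟩ h
      obtain ⟨rfl, rfl⟩ := List.cons_eq_cons.1 h
      rfl
    rw [tailFinset, Finset.card_image_of_injective _ hinj, Finset.card_product, Nat.card_Icc]
    have h1 := ih (n + 1)
    have h2 := lam_succ n
    rw [show n + 1 + k = n + (k + 1) by ring] at h1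
    push_cast
    rw [mul_assoc, h1, ← h2, pow_succ]
    ring

/-- The weight `λ(n + ℓ(u))` of a member of `tailB n`, extended by zero. -/
def weight (n : ℕ) : List ℕ → ℝ := (tailB n).indicator fun u => lam (n + u.length)

theorem weight_nonneg (n : ℕ) (u : List ℕ) : 0 ≤ weight n u :=
  Set.indicator_nonneg (fun _ _ => (lam_pos _).le) u

theorem weight_of_mem {n : ℕ} {u : List ℕ} (h : u ∈ tailB n) : weight n u = lam (n + u.length) :=
  Set.indicator_of_mem h _

theorem hasSum_weight (n : ℕ) : HasSum (weight n) (2 * lam n) := by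
  -- Grouping by length turns the sum into a geometric series with ratio `1 / 2`.
  rw [← (Equiv.sigmaFiberEquiv (List.length : List ℕ → ℕ)).hasSum_iff]
  have h1 : ∀ k : ℕ, HasSum (fun u : {u : List ℕ // u.length = k} => weight n u)
      (lam n * (1 / 2) ^ k) := by
    intro k
    have h2 : HasSum ({u : List ℕ | u.length = k}.indicator (weight n))
        (∑ u ∈ tailFinset n k, {u : List ℕ | u.length = k}.indicator (weight n) u) := by
      refine hasSum_sum_of_ne_finset_zero fun u hu => ?_
      rw [mem_tailFinset] at hu
      by_cases h : u.length = k
      · rw [Set.indicator_of_mem (s := {u : List ℕ | u.length = k}) h]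
        exact Set.indicator_of_notMem (fun h' => hu ⟨h', h⟩) _
      · exact Set.indicator_of_notMem (s := {u : List ℕ | u.length = k}) h _
    have h3 : ∑ u ∈ tailFinset n k, {u : List ℕ | u.length = k}.indicator (weight n) u =
        lam n * (1 / 2) ^ k := by
      rw [← card_tailFinset_mul_lam, ← nsmul_eq_mul]
      refine Finset.sum_eq_card_nsmul fun u hu => ?_
      rw [mem_tailFinset] at hu
      rw [Set.indicator_of_mem (s := {u : List ℕ | u.length = k}) hu.2, weight_of_mem hu.1, hu.2]
    rw [h3] at h2
    exact (hasSum_subtype_iff_indicator (s := {u : List ℕ | u.length = k})).2 h2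
  have h4 : HasSum (fun k : ℕ => lam n * (1 / 2) ^ k) (2 * lam n) := by
    rw [mul_comm]
    exact hasSum_geometric_two.mul_left _
  refine HasSum.sigma_of_hasSum h4 h1 ?_
  refine (summable_sigma_of_nonneg fun x => weight_nonneg n _).2 ⟨fun k => (h1 k).summable, ?_⟩
  have : (fun k => ∑' u : {u : List ℕ // u.length = k}, weight n u) =
      fun k => lam n * (1 / 2) ^ k := funext fun k => (h1 k).tsum_eq
  exact this ▸ h4.summable

/-- The total weight of a set of sequences. -/
def mass (n : ℕ) (S : Set (List ℕ)) : ℝ := ∑' u, S.indicator (weight n) u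

theorem summable_indicator_weight (n : ℕ) (S : Set (List ℕ)) :
    Summable (S.indicator (weight n)) := (hasSum_weight n).summable.indicator S

theorem mass_congr {n : ℕ} {S T : Set (List ℕ)} (h : ∀ u ∈ tailB n, u ∈ S ↔ u ∈ T) :
    mass n S = mass n T := by
  refine tsum_congr fun u => ?_
  by_cases hu : u ∈ tailB n
  · by_cases hS : u ∈ S
    · rw [Set.indicator_of_mem hS, Set.indicator_of_mem ((h u hu).1 hS)]
    · rw [Set.indicator_of_notMem hS, Set.indicator_of_notMem fun hT => hS ((h u hu).2 hT)]
  · have : weight n u = 0 := Set.indicator_of_notMem hu _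
    exact (Set.indicator_apply_eq_zero.2 fun _ => this).trans
      (Set.indicator_apply_eq_zero.2 fun _ => this).symm

theorem mass_mono {n : ℕ} {S T : Set (List ℕ)} (h : S ⊆ T) : mass n S ≤ mass n T :=
  Summable.tsum_le_tsum (fun u => Set.indicator_le_indicator_of_subset h (weight_nonneg n) u)
    (summable_indicator_weight n S) (summable_indicator_weight n T)

theorem mass_union {n : ℕ} {S T : Set (List ℕ)} (h : Disjoint S T) :
    mass n (S ∪ T) = mass n S + mass n T := by
  rw [mass, mass, mass, ← (summable_indicator_weight n S).tsum_add (summable_indicator_weight n T),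
    Set.indicator_union_of_disjoint h]

theorem mass_univ (n : ℕ) : mass n Set.univ = 2 * lam n := by
  rw [mass, Set.indicator_univ]
  exact (hasSum_weight n).tsum_eq

theorem mass_singleton {n : ℕ} {u : List ℕ} (h : u ∈ tailB n) :
    mass n {u} = lam (n + u.length) := by
  rw [mass, tsum_eq_single u fun v hv => Set.indicator_of_notMem (by simpa using hv) _,
    Set.indicator_of_mem (Set.mem_singleton u), weight_of_mem h]

theorem weight_append {n : ℕ} {v : List ℕ} (h : v ∈ tailB n) (u : List ℕ) :
    weight n (v ++ u) = weight (n + v.length) u := by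
  by_cases hu : u ∈ tailB (n + v.length)
  · rw [weight_of_mem hu, weight_of_mem (append_mem_tailB.2 ⟨h, hu⟩), List.length_append, add_assoc]
  · rw [weight, weight, Set.indicator_of_notMem hu,
      Set.indicator_of_notMem fun h' => hu (append_mem_tailB.1 h').2]

/-- Self-similarity of the weights: prefixing `v` only shifts the level by the length of `v`. -/
theorem mass_image_append {n : ℕ} {v : List ℕ} (h : v ∈ tailB n) (S : Set (List ℕ)) :
    mass n ((v ++ ·) '' S) = mass (n + v.length) S := by
  have hinj : Function.Injective (v ++ · : List ℕ → List ℕ) := List.append_right_injective v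
  rw [mass, ← hinj.tsum_eq]
  · refine tsum_congr fun u => ?_
    by_cases hu : u ∈ S
    · rw [Set.indicator_of_mem (Set.mem_image_of_mem (v ++ ·) hu), Set.indicator_of_mem hu, weight_append h]
    · rw [Set.indicator_of_notMem hu, Set.indicator_of_notMem]
      rintro ⟨w, hw, e⟩
      exact hu (hinj e ▸ hw)
  · intro u hu
    by_contra h'
    refine hu (Set.indicator_of_notMem ?_ _)
    rintro ⟨w, -, e⟩
    exact h' ⟨w, e⟩

/-! ### The lexicographic order -/

theorem append_lt_append_left_iff {s u v : List ℕ} : s ++ u < s ++ v ↔ u < v := by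
  refine ⟨fun h => ?_, List.append_left_lt⟩
  by_contra h'
  rcases (not_lt.1 h').lt_or_eq with h2 | rfl
  · exact lt_asymm h (List.append_left_lt h2)
  · exact lt_irrefl _ h

/-- Relative to `s`, a sequence is an extension of `s`, or smaller than all extensions of `s`, or
larger than all extensions of `s`. -/
theorem append_trichotomy (s u : List ℕ) :
    (∃ v, u = s ++ v) ∨ (∀ v, u < s ++ v) ∨ ∀ v, s ++ v < u := by
  induction s generalizing u with
  | nil => exact Or.inl ⟨u, rfl⟩
  | cons a s ih =>
    cases u with
    | nil => exact Or.inr (Or.inl fun v => List.nil_lt_cons _ _)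
    | cons b u =>
      rcases lt_trichotomy b a with h | rfl | h
      · exact Or.inr (Or.inl fun v => List.cons_lt_cons_iff.2 (Or.inl h))
      · rcases ih u with ⟨v, rfl⟩ | h | h
        · exact Or.inl ⟨v, rfl⟩
        · exact Or.inr (Or.inl fun v => List.cons_lt_cons_iff.2 (Or.inr ⟨rfl, h v⟩))
        · exact Or.inr (Or.inr fun v => List.cons_lt_cons_iff.2 (Or.inr ⟨rfl, h v⟩))
      · exact Or.inr (Or.inr fun v => List.cons_lt_cons_iff.2 (Or.inl h))

/-- A sequence below `s ++ v` that does not extend `s` is below every extension of `s`, in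
particular below `s` itself. -/
theorem Iio_append (s v : List ℕ) : Set.Iio (s ++ v) = Set.Iio s ∪ (s ++ ·) '' Set.Iio v := by
  ext u
  simp only [Set.mem_Iio, Set.mem_union, Set.mem_image]
  rcases append_trichotomy s u with ⟨w, rfl⟩ | h | h
  · rw [append_lt_append_left_iff]
    constructor
    · exact fun h => Or.inr ⟨w, h, rfl⟩
    · rintro (h | ⟨w', h, e⟩)
      · have : ¬ (s ++ w < s ++ []) := by
          rw [append_lt_append_left_iff]
          exact List.not_lt_nil w
        rw [List.append_nil] at this
        exact absurd h this
      · exact List.append_right_injective s e ▸ h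
  · exact iff_of_true (h v) (Or.inl (by simpa using h []))
  · refine iff_of_false (lt_asymm (h v)) ?_
    rintro (h' | ⟨w, -, rfl⟩)
    · exact lt_asymm h' (by simpa using h [])
    · exact lt_irrefl _ (h w)

theorem disjoint_Iio_image_append (s : List ℕ) (S : Set (List ℕ)) :
    Disjoint (Set.Iio s) ((s ++ ·) '' S) := by
  rw [Set.disjoint_left]
  rintro _ h ⟨v, -, rfl⟩
  have : s ++ v < s ++ [] := by simpa using h
  rw [append_lt_append_left_iff] at this
  exact List.not_lt_nil v this

/-! ### Offsets -/

/-- The weight of the members of `tailB n` that precede `v`. -/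
def offset (n : ℕ) (v : List ℕ) : ℝ := mass n (Set.Iio v)

theorem offset_nonneg (n : ℕ) (v : List ℕ) : 0 ≤ offset n v :=
  tsum_nonneg fun u => Set.indicator_nonneg (fun _ _ => weight_nonneg n _) u

theorem offset_nil (n : ℕ) : offset n [] = 0 := by
  have : Set.Iio ([] : List ℕ) = ∅ := Set.eq_empty_of_forall_notMem fun u => List.not_lt_nil u
  rw [offset, this, mass]
  simp

theorem offset_append {n : ℕ} {s : List ℕ} (h : s ∈ tailB n) (v : List ℕ) :
    offset n (s ++ v) = offset n s + offset (n + s.length) v := by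
  rw [offset, Iio_append, mass_union (disjoint_Iio_image_append _ _), mass_image_append h]
  rfl

/-- Everything before `u`, together with `u` itself, comes before `v`. Thus the intervals of length
`lam` starting at the offsets follow each other in lexicographic order and overlap in end points at
most. -/
theorem offset_add_lam_le {n : ℕ} {u v : List ℕ} (hu : u ∈ tailB n) (h : u < v) :
    offset n u + lam (n + u.length) ≤ offset n v := by
  rw [offset, ← mass_singleton hu, ← mass_union (by simp)]
  refine mass_mono ?_
  rintro w (hw | rfl)
  · exact lt_trans hw h
  · exact h

/-- The sequences before `u` and the extensions of `u` are disjoint; the extensions alone have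
weight `2 * lam (n + u.length)`. -/
theorem offset_add_le {n : ℕ} {u : List ℕ} (hu : u ∈ tailB n) :
    offset n u + 2 * lam (n + u.length) ≤ 2 * lam n := by
  rw [offset, ← mass_univ (n + u.length), ← mass_image_append hu,
    ← mass_union (disjoint_Iio_image_append _ _), ← mass_univ]
  exact mass_mono (Set.subset_univ _)

/-- Sequences starting with `0` also precede `[1]`, but they carry no weight; only the empty
sequence counts. -/
theorem offset_one (n : ℕ) : offset n [1] = lam n := by
  have h := mass_singleton (nil_mem_tailB n)
  rw [List.length_nil, add_zero] at h
  rw [offset, ← h]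
  refine mass_congr fun u hu => ?_
  cases u with
  | nil => exact iff_of_true (List.nil_lt_cons _ _) rfl
  | cons j u =>
    have := (cons_mem_tailB.1 hu).1.1
    refine iff_of_false ?_ (by simp)
    rw [Set.mem_Iio, List.cons_lt_cons_iff]
    rintro (h | ⟨-, h⟩)
    · omega
    · exact List.not_lt_nil u h

theorem singleton_mem_tailB {n j : ℕ} : [j] ∈ tailB n ↔ 1 ≤ j ∧ j ≤ n + 1 := by
  simp [cons_mem_tailB, nil_mem_tailB]

/-- What precedes `[j + 1]` but not `[j]` is exactly the block of all extensions of `[j]`. -/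
theorem offset_succ {n j : ℕ} (h1 : 1 ≤ j) (h2 : j ≤ n + 1) :
    offset n [j + 1] = offset n [j] + 2 * lam (n + 1) := by
  have hj : [j] ∈ tailB n := singleton_mem_tailB.2 ⟨h1, h2⟩
  have h := mass_image_append hj Set.univ
  rw [mass_univ] at h
  rw [offset, offset, show n + 1 = n + [j].length from rfl, ← h,
    ← mass_union (disjoint_Iio_image_append _ _)]
  congr 1
  ext u
  cases u with
  | nil => exact iff_of_true (List.nil_lt_cons _ _) (Or.inl (List.nil_lt_cons _ _))
  | cons i u =>
    simp only [Set.mem_Iio, Set.mem_union, List.cons_lt_cons_iff, Set.mem_image, List.not_lt_nil,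
      and_false, or_false, Set.mem_univ, true_and, List.singleton_append, List.cons_eq_cons,
      exists_eq_right]
    omega

theorem offset_singleton {n j : ℕ} (h : j ≤ n + 1) :
    offset n [j + 1] = lam n + j * (2 * lam (n + 1)) := by
  induction j with
  | zero => simp [offset_one]
  | succ j ih =>
    rw [offset_succ (by omega) h, ih (by omega)]
    push_cast
    ring

/-- The sequences that start with a given one cut out an initial piece of weight `λ` and `n + 1`
blocks, which exhaust the block. -/
theorem exists_offset_singleton_le {n : ℕ} {t : ℝ} (h0 : lam n ≤ t) (h1 : t ≤ 2 * lam n) :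
    ∃ j, [j] ∈ tailB n ∧ offset n [j] ≤ t ∧ t ≤ offset n [j] + 2 * lam (n + 1) := by
  have key : ∀ j : ℕ, j ≤ n → t ≤ lam n + (j + 1) * (2 * lam (n + 1)) →
      ∃ j, [j] ∈ tailB n ∧ offset n [j] ≤ t ∧ t ≤ offset n [j] + 2 * lam (n + 1) := by
    intro j
    induction j with
    | zero =>
      intro _ h
      refine ⟨1, singleton_mem_tailB.2 (by omega), ?_, ?_⟩ <;> rw [offset_one]
      · exact h0
      · simpa using h
    | succ j ih =>
      intro hj h
      by_cases h' : t ≤ lam n + (j + 1) * (2 * lam (n + 1))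
      · exact ih (by omega) h'
      · refine ⟨j + 1 + 1, singleton_mem_tailB.2 (by omega), ?_, ?_⟩ <;>
          rw [offset_singleton (by omega)] <;> push_cast at h h' ⊢ <;> linarith
  -- The last block ends at `lam n + (n + 1) * (2 * lam (n + 1)) = 2 * lam n`.
  refine key n le_rfl ?_
  rw [lam_succ]
  linarith

/-- The points of `[0, 2 λ(n)]` that lie in the interval of some member of `tailB n`. -/
def covered (n : ℕ) : Set ℝ :=
  {t | ∃ u ∈ tailB n, t ∈ Set.Icc (offset n u) (offset n u + lam (n + u.length))}

/-- Descending through the blocks, `t` either meets an interval on the way or ends up in a block `k`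
levels below, of length `2 * lam (n + k)`, whose left end point is covered. -/
theorem exists_mem_covered_abs_sub_le {n : ℕ} {t : ℝ} (h0 : 0 ≤ t) (h1 : t ≤ 2 * lam n) (k : ℕ) :
    ∃ t' ∈ covered n, |t - t'| ≤ 2 * lam (n + k) := by
  induction k generalizing n t with
  | zero =>
    refine ⟨0, ⟨[], nil_mem_tailB n, ?_⟩, ?_⟩
    · simp [offset_nil, (lam_pos n).le]
    · simpa [abs_of_nonneg h0] using h1
  | succ k ih =>
    rcases le_total t (lam n) with h | h
    · refine ⟨t, ⟨[], nil_mem_tailB n, ?_⟩, ?_⟩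
      · simp [offset_nil, h0, h]
      · simp [(lam_pos _).le]
    · obtain ⟨j, hj, h2, h3⟩ := exists_offset_singleton_le h h1
      obtain ⟨t', ⟨u, hu, h4⟩, h5⟩ := ih (n := n + 1) (t := t - offset n [j]) (by linarith)
        (by linarith)
      have e := offset_append hj u
      rw [List.length_singleton] at e
      refine ⟨t' + offset n [j], ⟨[j] ++ u, append_mem_tailB.2 ⟨hj, hu⟩, ?_⟩, ?_⟩
      · rw [e, List.length_append, List.length_singleton, ← add_assoc n 1]
        exact ⟨by linarith [h4.1], by linarith [h4.2]⟩
      · rw [show n + (k + 1) = n + 1 + k by ring]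
        convert h5 using 2
        ring

theorem tendsto_two_mul_lam (n : ℕ) :
    Filter.Tendsto (fun k => 2 * lam (n + k)) Filter.atTop (nhds 0) := by
  have h : Filter.Tendsto (fun k : ℕ => 2 * (1 / 2 : ℝ) ^ (k + n)) Filter.atTop (nhds (2 * 0)) :=
    ((Filter.tendsto_add_atTop_iff_nat n).2
      (tendsto_pow_atTop_nhds_zero_of_lt_one (by norm_num) (by norm_num))).const_mul 2
  rw [mul_zero] at h
  refine squeeze_zero (fun k => by have := lam_pos (n + k); positivity) (fun k => ?_) h
  rw [add_comm k n]
  exact mul_le_mul_of_nonneg_left (lam_le _) (by norm_num)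

theorem Icc_subset_closure_covered (n : ℕ) : Set.Icc 0 (2 * lam n) ⊆ closure (covered n) := by
  intro t ht
  rw [Metric.mem_closure_iff]
  intro ε hε
  obtain ⟨k, hk⟩ := ((tendsto_two_mul_lam n).eventually (gt_mem_nhds hε)).exists
  obtain ⟨t', h1, h2⟩ := exists_mem_covered_abs_sub_le ht.1 ht.2 k
  exact ⟨t', h1, h2.trans_lt hk⟩

theorem covered_subset_Icc (n : ℕ) : covered n ⊆ Set.Icc 0 (2 * lam n) := by
  rintro t ⟨u, hu, h1, h2⟩
  exact ⟨(offset_nonneg n u).trans h1,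
    by linarith [offset_add_le hu, lam_pos (n + u.length)]⟩

/-! ### The function `tau` -/

/-- The offset also counts the empty sequence, which is excluded from `seqB` and has weight `lam 0 =
1`. -/
theorem tau_eq_offset {s : List ℕ} (h : s ≠ []) : tau s = offset 0 s - 1 := by
  have h1 : offset 0 s = mass 0 {[]} + mass 0 (Set.Iio s \ {[]}) := by
    rw [offset, ← mass_union Set.disjoint_sdiff_right, Set.union_sdiff_cancel]
    rintro _ rfl
    exact lt_of_le_of_ne (not_lt.1 (List.not_lt_nil s)) h.symm
  rw [h1, mass_singleton (nil_mem_tailB 0), List.length_nil, add_zero, lam_zero, add_sub_cancel_left,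
    tau]
  refine (tsum_subtype {t : List ℕ | t ∈ seqB ∧ t < s} fun t => lam t.length).trans ?_
  refine tsum_congr fun u => ?_
  by_cases hu : u ∈ seqB ∧ u < s
  · rw [Set.indicator_of_mem (by exact hu), Set.indicator_of_mem,
      weight_of_mem (mem_seqB_iff.1 hu.1).2, zero_add]
    exact ⟨hu.2, (mem_seqB_iff.1 hu.1).1⟩
  · rw [Set.indicator_of_notMem (by exact hu)]
    symm
    by_cases h2 : u ∈ Set.Iio s \ {[]}
    · rw [Set.indicator_of_mem h2]
      exact Set.indicator_of_notMem (fun h3 => hu ⟨mem_seqB_iff.2 ⟨h2.2, h3⟩, h2.1⟩) _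
    · exact Set.indicator_of_notMem h2 _

theorem tau_append {s : List ℕ} (hs : s ∈ seqB) (v : List ℕ) :
    tau (s ++ v) = tau s + offset s.length v := by
  obtain ⟨h1, h2⟩ := mem_seqB_iff.1 hs
  rw [tau_eq_offset h1, tau_eq_offset (by simp [h1]), offset_append h2, zero_add]
  ring

theorem tau_add_lam_le {r s : List ℕ} (hr : r ∈ seqB) (h : r < s) :
    tau r + lam r.length ≤ tau s := by
  obtain ⟨h1, h2⟩ := mem_seqB_iff.1 hr
  have hs : s ≠ [] := by
    rintro rfl
    exact List.not_lt_nil r h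
  have := offset_add_lam_le h2 h
  rw [tau_eq_offset h1, tau_eq_offset hs]
  rw [zero_add] at this
  linarith

theorem tau_add_le_one {s : List ℕ} (hs : s ∈ seqB) : tau s + 2 * lam s.length ≤ 1 := by
  obtain ⟨h1, h2⟩ := mem_seqB_iff.1 hs
  have := offset_add_le h2
  rw [tau_eq_offset h1]
  rw [zero_add, lam_zero] at this
  linarith

theorem tau_nonneg (s : List ℕ) : 0 ≤ tau s := tsum_nonneg fun _ => (lam_pos _).le

theorem replicate_mem_seqB {n : ℕ} (hn : 1 ≤ n) : List.replicate n 1 ∈ seqB := by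
  refine ⟨by simp; omega, fun i hi => ?_⟩
  simp

theorem tau_one : tau [1] = 0 := by
  rw [tau_eq_offset (by simp), offset_one, lam_zero, sub_self]

theorem append_mem_seqB {s v : List ℕ} (hs : s ∈ seqB) (hv : v ∈ tailB s.length) :
    s ++ v ∈ seqB := by
  rw [mem_seqB_iff] at hs ⊢
  exact ⟨by simp [hs.1], append_mem_tailB.2 ⟨hs.2, by simpa using hv⟩⟩

open Hawaiian

/-! ### The loops `phi` and their commutators -/

theorem phi_mem_circle {n : ℕ} (hn : 1 ≤ n) (t : ℝ) : (phi n t).point ∈ circle n := by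
  have hn' : (n : ℝ) ≠ 0 := by positivity
  rw [mem_circle_iff, EuclideanSpace.norm_sq_eq]
  simp only [Fin.sum_univ_two, Real.norm_eq_abs, sq_abs, phi]
  simp
  field_simp
  linear_combination Real.sin_sq_add_cos_sq (2 * Real.pi * t)

theorem sameCircle_phi {n : ℕ} (hn : 1 ≤ n) (s t : ℝ) : SameCircle (phi n s) (phi n t) :=
  ⟨n, hn, phi_mem_circle hn s, phi_mem_circle hn t⟩

theorem lipschitzWith_phi {n : ℕ} (hn : 1 ≤ n) :
    LipschitzWith (2 * Real.pi / n).toNNReal (phi n) := by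
  have hn' : (0 : ℝ) < n := by positivity
  have hc : 0 ≤ 2 * Real.pi / (n : ℝ) := by positivity
  refine LipschitzWith.of_dist_le_mul fun s t => ?_
  rw [Real.coe_toNNReal _ hc, dist_of_same (sameCircle_phi hn s t), Real.dist_eq,
    ← abs_of_nonneg hc, ← abs_mul]
  refine abs_le_of_sq_le_sq' ?_ (abs_nonneg _) |>.2
  rw [sq_abs, EuclideanSpace.norm_sq_eq]
  simp only [Fin.sum_univ_two, Real.norm_eq_abs, sq_abs, phi, PiLp.sub_apply]
  simp
  -- The squared chord is `(2 - 2 cos δ) / n²` for the angle `δ`; this inequality bounds it by the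
  -- squared arc `δ² / n²`.
  have h := Real.one_sub_sq_div_two_le_cos (x := 2 * Real.pi * s - 2 * Real.pi * t)
  rw [Real.cos_sub] at h
  have e1 : (-(Real.cos (2 * Real.pi * s) / n) + (n : ℝ)⁻¹ -
      (-(Real.cos (2 * Real.pi * t) / n) + (n : ℝ)⁻¹)) ^ 2 +
      (Real.sin (2 * Real.pi * s) / n - Real.sin (2 * Real.pi * t) / n) ^ 2 =
      (2 - 2 * (Real.cos (2 * Real.pi * s) * Real.cos (2 * Real.pi * t) +
        Real.sin (2 * Real.pi * s) * Real.sin (2 * Real.pi * t))) / n ^ 2 := by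
    field_simp
    linear_combination Real.sin_sq_add_cos_sq (2 * Real.pi * s) +
      Real.sin_sq_add_cos_sq (2 * Real.pi * t)
  have e2 : (2 * Real.pi / n * (s - t)) ^ 2 =
      (2 * Real.pi * s - 2 * Real.pi * t) ^ 2 / n ^ 2 := by
    field_simp
  rw [e2]
  refine Eq.trans_le (Eq.trans ?_ e1) ?_
  · ring
  · gcongr
    linarith

theorem phi_zero (n : ℕ) : phi n 0 = origin := by
  ext i
  fin_cases i <;> simp [phi, origin]

theorem phi_one (n : ℕ) : phi n 1 = origin := by
  ext i
  fin_cases i <;> simp [phi, origin]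

/-- Points on different sides are compared through `a`, and `|s - a| + |a - t| = |s - t|`, so the
constant does not grow. -/
theorem lipschitzWith_ite {X : Type*} [PseudoMetricSpace X] {K : NNReal} {f g : ℝ → X} {a : ℝ}
    (hf : LipschitzWith K f) (hg : LipschitzWith K g) (h : f a = g a) :
    LipschitzWith K fun t => if t ≤ a then f t else g t := by
  have key : ∀ s t : ℝ, s ≤ a → a < t → dist (f s) (g t) ≤ K * |s - t| := by
    intro s t hs ht
    have h1 := hf.dist_le_mul s a
    have h2 := hg.dist_le_mul a t
    rw [Real.dist_eq] at h1 h2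
    calc dist (f s) (g t) ≤ dist (f s) (f a) + dist (g a) (g t) := by
          rw [← h]
          exact dist_triangle _ _ _
      _ ≤ K * |s - a| + K * |a - t| := add_le_add h1 h2
      _ = K * |s - t| := by
          rw [abs_of_nonpos (by linarith : s - a ≤ 0), abs_of_nonpos (by linarith : a - t ≤ 0),
            abs_of_nonpos (by linarith : s - t ≤ 0)]
          ring
  refine LipschitzWith.of_dist_le_mul fun s t => ?_
  simp only [Real.dist_eq]
  split_ifs with h1 h2 h2
  · exact hf.dist_le_mul s t
  · exact key s t h1 (not_le.1 h2)
  · rw [dist_comm, abs_sub_comm]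
    exact key t s h2 (not_le.1 h1)
  · exact hg.dist_le_mul s t

theorem lipschitzWith_comp_isometry {X : Type*} [PseudoMetricSpace X] {K : NNReal} {f : ℝ → X}
    (hf : LipschitzWith K f) {φ : ℝ → ℝ} (hφ : ∀ s t, |φ s - φ t| = |s - t|) :
    LipschitzWith K fun t => f (φ t) := by
  refine LipschitzWith.of_dist_le_mul fun s t => ?_
  have h := hf.dist_le_mul (φ s) (φ t)
  rwa [Real.dist_eq, hφ] at h

theorem lipschitzWith_commutatorLoop {m n : ℕ} (hm : 1 ≤ m) (hmn : m ≤ n) :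
    LipschitzWith (2 * Real.pi / m).toNNReal (commutatorLoop m n) := by
  have hn : 1 ≤ n := hm.trans hmn
  have hm' : (0 : ℝ) < m := by positivity
  have l1 := lipschitzWith_phi hm
  have l2 : LipschitzWith (2 * Real.pi / m).toNNReal (phi n) := by
    refine (lipschitzWith_phi hn).weaken (Real.toNNReal_le_toNNReal ?_)
    have : (m : ℝ) ≤ n := by exact_mod_cast hmn
    gcongr
  have k2 : LipschitzWith (2 * Real.pi / m).toNNReal fun u : ℝ => phi n (u - 1) := 
    lipschitzWith_comp_isometry l2 fun s t => by ring_nf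
  have k3 : LipschitzWith (2 * Real.pi / m).toNNReal fun u : ℝ => phi m (1 - (u - 2)) := 
    lipschitzWith_comp_isometry l1 fun s t => by
      rw [abs_sub_comm s]
      ring_nf
  have k4 : LipschitzWith (2 * Real.pi / m).toNNReal fun u : ℝ => phi n (1 - (u - 3)) := 
    lipschitzWith_comp_isometry l2 fun s t => by
      rw [abs_sub_comm s]
      ring_nf
  refine lipschitzWith_ite l1 (lipschitzWith_ite k2 (lipschitzWith_ite k3 k4 ?_) ?_) ?_
  · norm_num [phi_zero, phi_one]
  · norm_num [phi_zero, phi_one]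
  · norm_num [phi_zero, phi_one]

theorem commutatorLoop_eq_origin {m n : ℕ} {u : ℝ} (h : u = 0 ∨ u = 1 ∨ u = 2 ∨ u = 3 ∨ u = 4) :
    commutatorLoop m n u = origin := by
  rcases h with rfl | rfl | rfl | rfl | rfl <;> norm_num [commutatorLoop, phi_zero, phi_one]

theorem commutatorLoop_mem {m n : ℕ} {Z : Set Hawaiian} (hm : ∀ t, phi m t ∈ Z)
    (hn : ∀ t, phi n t ∈ Z) (u : ℝ) : commutatorLoop m n u ∈ Z := by
  unfold commutatorLoop
  split_ifs
  exacts [hm _, hn _, hm _, hn _]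

/-! ### Admissible sequences and the rescaled commutator loops -/

theorem exists_admissible : ∃ N : ℕ → ℕ, Admissible N := by
  -- With `N k = 32 / lam k` the speed condition reads `8π ≤ 32`, which follows from `π < 4`.
  refine ⟨fun k => 32 * (2 ^ k * k.factorial), fun k hk => ?_⟩
  have h0 : 0 < 2 ^ k * k.factorial := by positivity
  refine ⟨?_, ?_, ?_⟩
  · show 1 ≤ 32 * _
    omega
  · rw [lam]
    push_cast
    have h1 : (0 : ℝ) < 2 ^ k * k.factorial := by positivity
    rw [mul_div_assoc', div_le_div_iff₀ (by positivity) h1]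
    nlinarith [Real.pi_lt_four]
  · have : 2 ^ (k + 1) * (k + 1).factorial = 2 * (k + 1) * (2 ^ k * k.factorial) := by
      rw [Nat.factorial_succ, pow_succ]
      ring
    show 32 * _ + 1 < 32 * _
    rw [this]
    nlinarith

section

variable {N : ℕ → ℕ}

/-- The rescaled commutator has Lipschitz constant `(2π / N k) * (4 / lam k)`, which admissibility
bounds by one. -/
theorem lipschitzWith_cLoop (hN : Admissible N) {k : ℕ} (hk : 1 ≤ k) :
    LipschitzWith 1 (cLoop N k) := by
  obtain ⟨h1, h2, -⟩ := hN k hk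
  have hl := lam_pos k
  have h := (lipschitzWith_commutatorLoop h1 (Nat.le_succ (N k))).comp
    (LipschitzWith.of_dist_le_mul (K := (4 / lam k).toNNReal) (f := fun t : ℝ => 4 / lam k * t)
      fun s t => by
        rw [Real.dist_eq, Real.dist_eq, ← mul_sub, abs_mul, abs_of_pos (by positivity),
          Real.coe_toNNReal _ (by positivity)])
  have e : cLoop N k = fun t => commutatorLoop (N k) (N k).succ (4 / lam k * t) := by
    funext t
    rw [cLoop, div_mul_eq_mul_div]
  rw [e]
  refine h.weaken ?_
  rw [← NNReal.coe_le_coe, NNReal.coe_mul, Real.coe_toNNReal _ (by positivity),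
    Real.coe_toNNReal _ (by positivity), NNReal.coe_one, mul_div_assoc', div_le_one hl]
  linarith

theorem cLoop_zero (N : ℕ → ℕ) (k : ℕ) : cLoop N k 0 = origin :=
  commutatorLoop_eq_origin (Or.inl (by simp))

theorem cLoop_lam (N : ℕ → ℕ) (k : ℕ) : cLoop N k (lam k) = origin := by
  refine commutatorLoop_eq_origin ?_
  rw [mul_div_cancel_right₀ _ (lam_pos k).ne']
  norm_num

theorem tau_append_one {s : List ℕ} (hs : s ∈ seqB) : tau (s ++ [1]) = tau s + lam s.length := by
  rw [tau_append hs, offset_one]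

theorem one_le_length {s : List ℕ} (hs : s ∈ seqB) : 1 ≤ s.length :=
  Nat.one_le_iff_ne_zero.2 fun h => hs.1 (List.length_eq_zero_iff.1 h)

/-! ### Existence of `σ₁` -/

open Classical in
/-- The map that runs through the commutator loops on the intervals of the members of `seqB`, and
is constant elsewhere. -/
def sigmaOne (N : ℕ → ℕ) (t : Set.Icc (0 : ℝ) 1) : Hawaiian :=
  if h : ∃ s ∈ seqB, (t : ℝ) ∈ Set.Icc (tau s) (tau s + lam s.length) then
    cLoop N h.choose.length (t - tau h.choose)
  else origin

/-- Independence of the chosen sequence: if `t` lies in two intervals, it is the right end of one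
and the left end of the other, where both loops are at the origin. -/
theorem sigmaOne_of_mem {s : List ℕ} (hs : s ∈ seqB) {t : Set.Icc (0 : ℝ) 1}
    (ht : (t : ℝ) ∈ Set.Icc (tau s) (tau s + lam s.length)) :
    sigmaOne N t = cLoop N s.length (t - tau s) := by
  have h : ∃ s ∈ seqB, (t : ℝ) ∈ Set.Icc (tau s) (tau s + lam s.length) := ⟨s, hs, ht⟩
  rw [sigmaOne, dif_pos h]
  obtain ⟨hr, hr2⟩ := h.choose_spec
  generalize h.choose = r at hr hr2
  have key : ∀ {r s : List ℕ}, r ∈ seqB → r < s →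
      (t : ℝ) ∈ Set.Icc (tau r) (tau r + lam r.length) →
      (t : ℝ) ∈ Set.Icc (tau s) (tau s + lam s.length) →
      cLoop N r.length (t - tau r) = cLoop N s.length (t - tau s) := by
    intro r s hr hrs h1 h2
    have h3 := tau_add_lam_le hr hrs
    have e1 : (t : ℝ) - tau r = lam r.length := by linarith [h1.2, h2.1]
    have e2 : (t : ℝ) - tau s = 0 := by linarith [h1.2, h2.1]
    rw [e1, e2, cLoop_lam, cLoop_zero]
  rcases lt_trichotomy r s with h | rfl | h
  · exact key hr h hr2 ht
  · rfl
  · exact (key hs h ht hr2).symm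

theorem sigmaOne_of_forall_notMem {t : Set.Icc (0 : ℝ) 1}
    (h : ∀ s ∈ seqB, (t : ℝ) ∉ Set.Icc (tau s) (tau s + lam s.length)) :
    sigmaOne N t = origin := by
  rw [sigmaOne, dif_neg]
  rintro ⟨s, hs, hs2⟩
  exact h s hs hs2

/-- Inside one interval this is the bound for `cLoop`. Otherwise both values are compared with the
origin, attained at the right end of the interval of `x` and the left end of that of `y`; these ends
are in order between `x` and `y`. Points in no interval are mapped to the origin themselves. -/
theorem lipschitzWith_sigmaOne (hN : Admissible N) : LipschitzWith 1 (sigmaOne N) := by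
  have hL : ∀ {s : List ℕ}, s ∈ seqB → ∀ x y : ℝ,
      dist (cLoop N s.length x) (cLoop N s.length y) ≤ |x - y| := by
    intro s hs x y
    simpa [Real.dist_eq] using (lipschitzWith_cLoop hN (one_le_length hs)).dist_le_mul x y
  have hr : ∀ {s : List ℕ} (x : Set.Icc (0 : ℝ) 1), s ∈ seqB →
      (x : ℝ) ∈ Set.Icc (tau s) (tau s + lam s.length) →
      dist (sigmaOne N x) origin ≤ tau s + lam s.length - x := by
    intro s x hs hx
    have h := hL hs (x - tau s) (lam s.length)
    rw [cLoop_lam, abs_of_nonpos (by linarith [hx.2])] at h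
    rw [sigmaOne_of_mem hs hx]
    linarith
  have hl : ∀ {s : List ℕ} (x : Set.Icc (0 : ℝ) 1), s ∈ seqB →
      (x : ℝ) ∈ Set.Icc (tau s) (tau s + lam s.length) →
      dist (sigmaOne N x) origin ≤ x - tau s := by
    intro s x hs hx
    have h := hL hs (x - tau s) 0
    rw [cLoop_zero, sub_zero, abs_of_nonneg (by linarith [hx.1])] at h
    rw [sigmaOne_of_mem hs hx]
    exact h
  have key : ∀ x y : Set.Icc (0 : ℝ) 1, (x : ℝ) ≤ y →
      dist (sigmaOne N x) (sigmaOne N y) ≤ y - x := by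
    intro x y hxy
    by_cases hx : ∃ s ∈ seqB, (x : ℝ) ∈ Set.Icc (tau s) (tau s + lam s.length)
    · obtain ⟨s, hs, hx⟩ := hx
      by_cases hys : (y : ℝ) ∈ Set.Icc (tau s) (tau s + lam s.length)
      · have h := hL hs (x - tau s) (y - tau s)
        rw [sub_sub_sub_cancel_right, abs_of_nonpos (by linarith)] at h
        rw [sigmaOne_of_mem hs hx, sigmaOne_of_mem hs hys]
        linarith
      · have h1 : tau s + lam s.length < y := by
          by_contra h
          exact hys ⟨hx.1.trans hxy, not_lt.1 h⟩
        by_cases hy : ∃ r ∈ seqB, (y : ℝ) ∈ Set.Icc (tau r) (tau r + lam r.length)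
        · obtain ⟨r, hr', hy⟩ := hy
          rcases lt_trichotomy s r with h | rfl | h
          · have h2 := tau_add_lam_le hs h
            have h3 := dist_triangle_right (sigmaOne N x) (sigmaOne N y) origin
            linarith [hr x hs hx, hl y hr' hy]
          · exact absurd hy hys
          · have h2 := tau_add_lam_le hr' h
            linarith [hy.2, hx.1, lam_pos s.length]
        · rw [sigmaOne_of_forall_notMem (t := y) fun r hr h => hy ⟨r, hr, h⟩]
          linarith [hr x hs hx]
    · rw [sigmaOne_of_forall_notMem (t := x) fun r hr h => hx ⟨r, hr, h⟩]
      by_cases hy : ∃ r ∈ seqB, (y : ℝ) ∈ Set.Icc (tau r) (tau r + lam r.length)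
      · obtain ⟨r, hr', hy⟩ := hy
        have h1 : (x : ℝ) < tau r := by
          by_contra h
          exact hx ⟨r, hr', not_lt.1 h, hxy.trans hy.2⟩
        rw [dist_comm]
        linarith [hl y hr' hy]
      · rw [sigmaOne_of_forall_notMem (t := y) fun r hr h => hy ⟨r, hr, h⟩, dist_self]
        linarith
  refine LipschitzWith.of_dist_le_mul fun x y => ?_
  rw [NNReal.coe_one, one_mul, Subtype.dist_eq, Real.dist_eq]
  rcases le_total (x : ℝ) y with h | h
  · rw [abs_sub_comm]
    exact (key x y h).trans (le_abs_self _)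
  · rw [dist_comm]
    exact (key y x h).trans (le_abs_self _)

theorem isSigmaOne_sigmaOne (hN : Admissible N) : IsSigmaOne N (sigmaOne N) := by
  refine ⟨lipschitzWith_sigmaOne hN, fun s hs t h1 h2 => ?_⟩
  rw [tau_append_one hs] at h2
  exact sigmaOne_of_mem hs ⟨h1, h2⟩

/-! ### Uniqueness and self-similarity -/

variable {σ : Set.Icc (0 : ℝ) 1 → Hawaiian}

theorem IsSigmaOne.lipschitzWith_extend (h : IsSigmaOne N σ) :
    LipschitzWith 1 (Set.IccExtend zero_le_one σ) := by
  have := h.1.comp (LipschitzWith.projIcc (zero_le_one (α := ℝ)))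
  rwa [one_mul] at this

/-- In the coordinate `t` relative to the start of the block of `s`, the right-hand side depends on
`s` through its length only. -/
theorem IsSigmaOne.extend_eq_cLoop (h : IsSigmaOne N σ) {s u : List ℕ} (hs : s ∈ seqB)
    (hu : u ∈ tailB s.length) {t : ℝ}
    (ht : t ∈ Set.Icc (offset s.length u) (offset s.length u + lam (s.length + u.length))) :
    Set.IccExtend zero_le_one σ (tau s + t) =
      cLoop N (s.length + u.length) (t - offset s.length u) := by
  have hsu := append_mem_seqB hs hu
  have e := tau_append hs u
  have h1 : tau s + t ∈ Set.Icc (0 : ℝ) 1 := by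
    have h2 := covered_subset_Icc s.length ⟨u, hu, ht⟩
    exact ⟨add_nonneg (tau_nonneg s) h2.1, by linarith [tau_add_le_one hs, h2.2]⟩
  rw [Set.IccExtend_of_mem _ _ h1, h.2 _ hsu ⟨_, h1⟩, List.length_append, e]
  · congr 1
    ring
  · show _ ≤ tau s + t
    linarith [ht.1]
  · show tau s + t ≤ _
    rw [tau_append_one hsu, e, List.length_append]
    linarith [ht.2]

theorem eqOn_Icc_of_eqOn_covered {X : Type*} [TopologicalSpace X] [T2Space X] {n : ℕ}
    {f g : ℝ → X} (hf : Continuous f) (hg : Continuous g) (h : Set.EqOn f g (covered n)) :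
    Set.EqOn f g (Set.Icc 0 (2 * lam n)) :=
  (h.closure hf hg).mono (Icc_subset_closure_covered n)

/-- On the dense covered set both sides are given by the same formula, and continuity does the rest.
The case `s = s'` yields uniqueness, the case `σ = σ'` self-similarity. -/
theorem IsSigmaOne.extend_eq_extend {σ' : Set.Icc (0 : ℝ) 1 → Hawaiian} (h : IsSigmaOne N σ)
    (h' : IsSigmaOne N σ') {s s' : List ℕ} (hs : s ∈ seqB) (hs' : s' ∈ seqB)
    (hss' : s.length = s'.length) {t : ℝ} (ht : t ∈ Set.Icc 0 (2 * lam s.length)) :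
    Set.IccExtend zero_le_one σ (tau s + t) = Set.IccExtend zero_le_one σ' (tau s' + t) := by
  have c := h.lipschitzWith_extend.continuous
  have c' := h'.lipschitzWith_extend.continuous
  refine eqOn_Icc_of_eqOn_covered (f := fun t => Set.IccExtend zero_le_one σ (tau s + t))
    (g := fun t => Set.IccExtend zero_le_one σ' (tau s' + t))
    (c.comp (continuous_const_add _)) (c'.comp (continuous_const_add _)) ?_ ht
  rintro t ⟨u, hu, ht⟩
  have e := h.extend_eq_cLoop hs hu ht
  rw [hss'] at hu ht e
  exact e.trans (h'.extend_eq_cLoop hs' hu ht).symm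

theorem singleton_one_mem_seqB : [1] ∈ seqB := replicate_mem_seqB (n := 1) le_rfl

theorem two_mul_lam_one : 2 * lam 1 = 1 := by norm_num [lam]

theorem IsSigmaOne.unique {σ' : Set.Icc (0 : ℝ) 1 → Hawaiian} (h : IsSigmaOne N σ)
    (h' : IsSigmaOne N σ') : σ = σ' := by
  funext t
  -- The block of the sequence `[1]` is the whole unit interval, as `tau [1] = 0` and `2 * lam 1 =
  -- 1`.
  have e := h.extend_eq_extend h' singleton_one_mem_seqB singleton_one_mem_seqB rfl
    (t := t) (by rw [List.length_singleton, two_mul_lam_one]; exact t.2)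
  rw [tau_one, zero_add] at e
  simpa using e

theorem IsSigmaOne.extend_tau (h : IsSigmaOne N σ) {s : List ℕ} (hs : s ∈ seqB) :
    Set.IccExtend zero_le_one σ (tau s) = origin := by
  have e := h.extend_eq_cLoop hs (nil_mem_tailB s.length) (t := 0)
    (by simp [offset_nil, (lam_pos _).le])
  rwa [offset_nil, add_zero, sub_zero, cLoop_zero] at e

/-- The right end of a block is also the right end of its last sub-block, that of `s ++ [s.length +
1]`. Each such block starts at the origin and their lengths tend to zero, so the `1`-Lipschitz bound
forces the value. -/
theorem IsSigmaOne.extend_tau_add (h : IsSigmaOne N σ) {s : List ℕ} (hs : s ∈ seqB) :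
    Set.IccExtend zero_le_one σ (tau s + 2 * lam s.length) = origin := by
  have key : ∀ (k : ℕ) {s : List ℕ}, s ∈ seqB →
      dist (Set.IccExtend zero_le_one σ (tau s + 2 * lam s.length)) origin ≤
        2 * lam (s.length + k) := by
    intro k
    induction k with
    | zero =>
      intro s hs
      have h1 := h.lipschitzWith_extend.dist_le_mul (tau s + 2 * lam s.length) (tau s)
      rw [h.extend_tau hs, Real.dist_eq, add_sub_cancel_left, NNReal.coe_one, one_mul,
        abs_of_pos (by have := lam_pos s.length; positivity)] at h1
      exact h1
    | succ k ih =>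
      intro s hs
      have h1 : [s.length + 1] ∈ tailB s.length := singleton_mem_tailB.2 (by omega)
      have h2 := ih (append_mem_seqB hs h1)
      have e : tau (s ++ [s.length + 1]) + 2 * lam (s ++ [s.length + 1]).length =
          tau s + 2 * lam s.length := by
        rw [tau_append hs, offset_singleton (by omega), List.length_append, List.length_singleton]
        linear_combination lam_succ s.length
      rw [e, List.length_append, List.length_singleton, add_assoc, add_comm 1] at h2
      exact h2
  exact dist_le_zero.1 (ge_of_tendsto' (tendsto_two_mul_lam s.length) fun k => key k hs)

theorem IsSigmaOne.isLipschitzLoop_sigma (h : IsSigmaOne N σ) {n : ℕ} (hn : 1 ≤ n) :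
    IsLipschitzLoop origin (2 * lam n) (sigma σ n) where
  nonneg := by have := lam_pos n; positivity
  lipschitz := ⟨1, (lipschitzWith_comp_isometry h.lipschitzWith_extend fun s t => by
    rw [add_sub_add_right_eq_sub]).lipschitzOnWith⟩
  source := by
    rw [sigma, zero_add]
    exact h.extend_tau (replicate_mem_seqB hn)
  target := by
    rw [sigma, add_comm]
    simpa using h.extend_tau_add (replicate_mem_seqB hn)

theorem sigma_one (σ : Set.Icc (0 : ℝ) 1 → Hawaiian) (t : Set.Icc (0 : ℝ) 1) :
    sigma σ 1 t = σ t := by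
  have : tau (List.replicate 1 1) = 0 := tau_one
  rw [sigma, this, add_zero]
  simp

/-- On the block of a sequence `s`, the map stays in any closed set that contains the circles used
from level `ℓ(s)` on. -/
theorem IsSigmaOne.extend_mem (h : IsSigmaOne N σ) {s : List ℕ} (hs : s ∈ seqB)
    {Z : Set Hawaiian} (hZ : IsClosed Z)
    (hk : ∀ k, s.length ≤ k → ∀ t, phi (N k) t ∈ Z ∧ phi (N k + 1) t ∈ Z)
    {t : ℝ} (ht : t ∈ Set.Icc 0 (2 * lam s.length)) :
    Set.IccExtend zero_le_one σ (tau s + t) ∈ Z := by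
  have c := h.lipschitzWith_extend.continuous.comp (continuous_const_add (tau s))
  have h1 : covered s.length ⊆ (fun t => Set.IccExtend zero_le_one σ (tau s + t)) ⁻¹' Z := by
    rintro t ⟨u, hu, ht⟩
    rw [Set.mem_preimage, h.extend_eq_cLoop hs hu ht]
    exact commutatorLoop_mem (fun t => (hk _ (Nat.le_add_right _ _) t).1)
      (fun t => (hk _ (Nat.le_add_right _ _) t).2) _
  exact closure_minimal h1 (hZ.preimage c) (Icc_subset_closure_covered _ ht)

/-! ### Values of invariants -/

namespace LoopInvariant

variable {A : Type*} [Group A]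

/-- The constant loop is its own concatenation with itself, so its value is idempotent. -/
theorem val_affine_self {X : Type} [MetricSpace X] {x₀ : X} (F : LoopInvariant x₀ A) {K : NNReal}
    {g : ℝ → X} (hg : LipschitzWith K g) {x : ℝ} (hx : g x = x₀) :
    F.val (isLipschitzLoop_affine hg hx hx) = 1 := by
  have h := F.trans hg hx hx hx
  exact left_eq_mul.1 h

variable (F : LoopInvariant origin A)

/-- The value of an invariant on the `n`-th circle. -/
def phiVal (n : ℕ) (hn : 1 ≤ n) : A :=
  F.val (isLipschitzLoop_affine (lipschitzWith_phi hn) (phi_zero n) (phi_one n))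

/-- The concatenation rule is applied to the parameters `0`, `1`, `0`. -/
theorem val_phi_symm (n : ℕ) (hn : 1 ≤ n) :
    F.val (isLipschitzLoop_affine (lipschitzWith_phi hn) (phi_one n) (phi_zero n)) =
      (F.phiVal n hn)⁻¹ := by
  have h := F.trans (lipschitzWith_phi hn) (phi_zero n) (phi_one n) (phi_zero n)
  rw [F.val_affine_self (lipschitzWith_phi hn) (phi_zero n)] at h
  exact eq_inv_of_mul_eq_one_left h.symm

theorem val_commutatorLoop {m n : ℕ} (hm : 1 ≤ m) (hmn : m ≤ n) :
    F.val (isLipschitzLoop_affine (lipschitzWith_commutatorLoop hm hmn)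
      (x := 0) (y := 4) (commutatorLoop_eq_origin (by norm_num))
      (commutatorLoop_eq_origin (by norm_num))) =
    (F.phiVal n (hm.trans hmn))⁻¹ * (F.phiVal m hm)⁻¹ * F.phiVal n (hm.trans hmn) *
      F.phiVal m hm := by
  have o : ∀ i : ℝ, i = 0 ∨ i = 1 ∨ i = 2 ∨ i = 3 ∨ i = 4 → commutatorLoop m n i = origin :=
    fun i => commutatorLoop_eq_origin
  have hg := lipschitzWith_commutatorLoop hm hmn
  have hn := hm.trans hmn
  have h0 := o 0 (by norm_num)
  have h1 := o 1 (by norm_num)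
  have h2 := o 2 (by norm_num)
  have h3 := o 3 (by norm_num)
  have h4 := o 4 (by norm_num)
  rw [F.trans hg h0 h1 h4, F.trans hg h1 h2 h4, F.trans hg h2 h3 h4]
  have k1 : F.val (isLipschitzLoop_affine hg h0 h1) = F.phiVal m hm := by
    refine F.congr _ _ fun t ht => ?_
    show commutatorLoop m n (0 + (1 - 0) * (1 * t)) = phi m (0 + (1 - 0) * (1 * t))
    rw [commutatorLoop, if_pos (by linarith [ht.2])]
  have k2 : F.val (isLipschitzLoop_affine hg h1 h2) = F.phiVal n hn := by
    refine F.congr _ _ fun t ht => ?_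
    show commutatorLoop m n (1 + (2 - 1) * (1 * t)) = phi n (0 + (1 - 0) * (1 * t))
    -- At `t = 0` the definition still selects the preceding branch; both branches give the origin
    -- there.
    rcases ht.1.eq_or_lt with rfl | h
    · norm_num [h1, phi_zero]
    · rw [commutatorLoop, if_neg (by linarith), if_pos (by linarith [ht.2])]
      ring_nf
  have k3 : F.val (isLipschitzLoop_affine hg h2 h3) = (F.phiVal m hm)⁻¹ := by
    rw [← val_phi_symm]
    refine F.congr _ _ fun t ht => ?_
    show commutatorLoop m n (2 + (3 - 2) * (1 * t)) = phi m (1 + (0 - 1) * (1 * t))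
    rcases ht.1.eq_or_lt with rfl | h
    · norm_num [h2, phi_one]
    · rw [commutatorLoop, if_neg (by linarith), if_neg (by linarith),
        if_pos (by linarith [ht.2])]
      ring_nf
  have k4 : F.val (isLipschitzLoop_affine hg h3 h4) = (F.phiVal n hn)⁻¹ := by
    rw [← val_phi_symm]
    refine F.congr _ _ fun t ht => ?_
    show commutatorLoop m n (3 + (4 - 3) * (1 * t)) = phi n (1 + (0 - 1) * (1 * t))
    rcases ht.1.eq_or_lt with rfl | h
    · norm_num [h3, phi_one]
    · rw [commutatorLoop, if_neg (by linarith), if_neg (by linarith), if_neg (by linarith)]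
      ring_nf
  rw [k1, k2, k3, k4]

variable {N : ℕ → ℕ} {σ : Set.Icc (0 : ℝ) 1 → Hawaiian}

/-- The loop `σ_n` is the commutator loop `c_n` followed by `n + 1` copies of `σ_{n+1}`. -/
theorem val_sigma (h : IsSigmaOne N σ) {n : ℕ} (hn : 1 ≤ n)
    (hN1 : 1 ≤ N n) (hN2 : 1 ≤ N n + 1) :
    F.val (h.isLipschitzLoop_sigma hn) =
      F.val (h.isLipschitzLoop_sigma (Nat.le_succ_of_le hn)) ^ (n + 1) *
        ((F.phiVal (N n + 1) hN2)⁻¹ * (F.phiVal (N n) hN1)⁻¹ * F.phiVal (N n + 1) hN2 *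
          F.phiVal (N n) hN1) := by
  set s := List.replicate n 1 with hs'
  have hs : s ∈ seqB := replicate_mem_seqB hn
  have hsn : s.length = n := List.length_replicate
  have hg := h.lipschitzWith_extend
  set g := Set.IccExtend zero_le_one σ with hg'
  have hsj : ∀ j : ℕ, j ≤ n → s ++ [j + 1] ∈ seqB := fun j hj =>
    append_mem_seqB hs (singleton_mem_tailB.2 (by omega))
  have hτ : ∀ j : ℕ, j ≤ n + 1 → tau (s ++ [j + 1]) = tau s + lam n + j * (2 * lam (n + 1)) := by
    intro j hj
    rw [tau_append hs, hsn, offset_singleton hj]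
    ring
  have hend : tau s + 2 * lam n = tau s + lam n + (n + 1 : ℕ) * (2 * lam (n + 1)) := by
    push_cast
    linear_combination -lam_succ n
  have o : ∀ j : ℕ, j ≤ n + 1 → g (tau s + lam n + j * (2 * lam (n + 1))) = origin := by
    intro j hj
    rcases hj.eq_or_lt with rfl | hj'
    · rw [← hend, ← hsn]
      exact h.extend_tau_add hs
    · rw [← hτ j hj]
      exact h.extend_tau (hsj j (by omega))
  have o0 : g (tau s) = origin := h.extend_tau hs
  have o1 : g (tau s + lam n) = origin := by simpa using o 0 (Nat.zero_le _)
  have o2 : g (tau s + 2 * lam n) = origin := hend ▸ o (n + 1) le_rfl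
  have e1 : F.val (h.isLipschitzLoop_sigma hn) = F.val (isLipschitzLoop_affine hg o0 o2) := by
    refine F.congr _ _ fun t ht => ?_
    show g (2 * lam n * t + tau s) = g (tau s + (tau s + 2 * lam n - tau s) * (1 * t))
    congr 1
    ring
  have hc : F.val (isLipschitzLoop_affine hg o0 o1) =
      (F.phiVal (N n + 1) hN2)⁻¹ * (F.phiVal (N n) hN1)⁻¹ * F.phiVal (N n + 1) hN2 *
          F.phiVal (N n) hN1 := by
    rw [← F.val_commutatorLoop hN1 (Nat.le_succ (N n))]
    refine F.congr _ _ fun t ht => ?_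
    have h1 := h.extend_eq_cLoop hs (nil_mem_tailB _) (t := lam n * t) (by
      rw [offset_nil, List.length_nil, add_zero, hsn, zero_add]
      exact ⟨mul_nonneg (lam_pos n).le ht.1, mul_le_of_le_one_right (lam_pos n).le ht.2⟩)
    rw [offset_nil, List.length_nil, add_zero, hsn, sub_zero, cLoop] at h1
    show g (tau s + (tau s + lam n - tau s) * (1 * t)) =
      commutatorLoop (N n) (N n + 1) (0 + (4 - 0) * (1 * t))
    have hl := (lam_pos n).ne'
    rw [show tau s + (tau s + lam n - tau s) * (1 * t) = tau s + lam n * t by ring]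
    refine h1.trans ?_
    congr 1
    field_simp
    ring
  have hp : ∀ (j : ℕ) (hj : j ≤ n + 1), F.val (isLipschitzLoop_affine hg o1 (o j hj)) =
      F.val (h.isLipschitzLoop_sigma (Nat.le_succ_of_le hn)) ^ j := by
    intro j
    induction j with
    | zero =>
      intro hj
      rw [pow_zero, ← F.val_affine_self hg o1]
      refine F.congr _ _ fun t ht => ?_
      simp
    | succ j ih =>
      intro hj
      rw [F.trans hg o1 (o j (by omega)) (o (j + 1) hj), ih (by omega), pow_succ']
      congr 1
      refine F.congr _ _ fun t ht => ?_
      have hl := lam_pos (n + 1)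
      -- The block of `s ++ [j + 1]` has the same level as that of `n + 1` ones, so the map on it is
      -- a copy of `σ_{n+1}`.
      have h1 := h.extend_eq_extend h (hsj j (by omega))
        (replicate_mem_seqB (Nat.le_succ_of_le hn)) (by simp [hsn]) (t := 2 * lam (n + 1) * t) (by
          rw [List.length_append, List.length_singleton, hsn]
          exact ⟨mul_nonneg (by positivity) ht.1, mul_le_of_le_one_right (by positivity) ht.2⟩)
      rw [hτ j (by omega)] at h1
      refine Eq.trans ?_ (h1.trans ?_)
      · show g _ = g _
        congr 1
        push_cast
        ring
      · show g _ = g _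
        congr 1
        exact add_comm _ _
  rw [e1, F.trans hg o0 o1 o2, hc, ← hp (n + 1) le_rfl]
  congr 1
  exact F.congr _ _ fun t ht => by simp only [hend]

end LoopInvariant

end

/-! ### The Heisenberg group -/

/-- The real Heisenberg group. -/
def Heis : Type := ℝ × ℝ × ℝ

namespace Heis

/-- The element of the Heisenberg group with given coordinates. -/
def mk (x y z : ℝ) : Heis := (x, y, z)

instance : TopologicalSpace Heis := inferInstanceAs (TopologicalSpace (ℝ × ℝ × ℝ))

@[ext]
theorem ext {a b : Heis} (h1 : a.1 = b.1) (h2 : a.2.1 = b.2.1) (h3 : a.2.2 = b.2.2) : a = b :=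
  Prod.ext h1 (Prod.ext h2 h3)

/-- The product is that of upper unitriangular `3 × 3` matrices with `x`, `y` above the diagonal and
`z` in the corner. -/
instance : Group Heis where
  mul a b := (a.1 + b.1, a.2.1 + b.2.1, a.2.2 + b.2.2 + a.1 * b.2.1)
  one := (0, 0, 0)
  inv a := (-a.1, -a.2.1, -a.2.2 + a.1 * a.2.1)
  mul_assoc a b c := by
    apply ext
    · exact add_assoc _ _ _
    · exact add_assoc _ _ _
    · show a.2.2 + b.2.2 + a.1 * b.2.1 + c.2.2 + (a.1 + b.1) * c.2.1 =
        a.2.2 + (b.2.2 + c.2.2 + b.1 * c.2.1) + a.1 * (b.2.1 + c.2.1)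
      ring
  one_mul a := by
    apply ext
    · exact zero_add _
    · exact zero_add _
    · show 0 + a.2.2 + 0 * a.2.1 = a.2.2
      ring
  mul_one a := by
    apply ext
    · exact add_zero _
    · exact add_zero _
    · show a.2.2 + 0 + a.1 * 0 = a.2.2
      ring
  inv_mul_cancel a := by
    apply ext
    · exact neg_add_cancel _
    · exact neg_add_cancel _
    · show -a.2.2 + a.1 * a.2.1 + a.2.2 + -a.1 * a.2.1 = 0
      ring

theorem mk_fst (x y z : ℝ) : (mk x y z).1 = x := rfl
theorem mk_snd (x y z : ℝ) : (mk x y z).2.1 = y := rfl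
theorem mk_trd (x y z : ℝ) : (mk x y z).2.2 = z := rfl
theorem one_fst : (1 : Heis).1 = 0 := rfl
theorem one_snd : (1 : Heis).2.1 = 0 := rfl
theorem one_trd : (1 : Heis).2.2 = 0 := rfl
theorem mul_fst (a b : Heis) : (a * b).1 = a.1 + b.1 := rfl
theorem mul_snd (a b : Heis) : (a * b).2.1 = a.2.1 + b.2.1 := rfl
theorem mul_trd (a b : Heis) : (a * b).2.2 = a.2.2 + b.2.2 + a.1 * b.2.1 := rfl
theorem inv_fst (a : Heis) : (a⁻¹).1 = -a.1 := rfl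
theorem inv_snd (a : Heis) : (a⁻¹).2.1 = -a.2.1 := rfl
theorem inv_trd (a : Heis) : (a⁻¹).2.2 = -a.2.2 + a.1 * a.2.1 := rfl

instance : IsTopologicalGroup Heis where
  continuous_mul := by
    show Continuous fun p : (ℝ × ℝ × ℝ) × (ℝ × ℝ × ℝ) =>
      (p.1.1 + p.2.1, p.1.2.1 + p.2.2.1, p.1.2.2 + p.2.2.2 + p.1.1 * p.2.2.1)
    fun_prop
  continuous_inv := by
    show Continuous fun a : ℝ × ℝ × ℝ => (-a.1, -a.2.1, -a.2.2 + a.1 * a.2.1)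
    fun_prop

/-- The subgroup of elements with integral coordinates. -/
def integral : Subgroup Heis where
  carrier := {a | (∃ k : ℤ, (k : ℝ) = a.1) ∧ (∃ k : ℤ, (k : ℝ) = a.2.1) ∧ ∃ k : ℤ, (k : ℝ) = a.2.2}
  one_mem' := ⟨⟨0, Int.cast_zero⟩, ⟨0, Int.cast_zero⟩, ⟨0, Int.cast_zero⟩⟩
  mul_mem' := by
    rintro a b ⟨⟨i, hi⟩, ⟨j, hj⟩, ⟨k, hk⟩⟩ ⟨⟨i', hi'⟩, ⟨j', hj'⟩, ⟨k', hk'⟩⟩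
    refine ⟨⟨i + i', ?_⟩, ⟨j + j', ?_⟩, ⟨k + k' + i * j', ?_⟩⟩
    · rw [mul_fst]; push_cast; rw [hi, hi']
    · rw [mul_snd]; push_cast; rw [hj, hj']
    · rw [mul_trd]; push_cast; rw [hi, hj', hk, hk']
  inv_mem' := by
    rintro a ⟨⟨i, hi⟩, ⟨j, hj⟩, ⟨k, hk⟩⟩
    refine ⟨⟨-i, ?_⟩, ⟨-j, ?_⟩, ⟨-k + i * j, ?_⟩⟩
    · rw [inv_fst]; push_cast; rw [hi]
    · rw [inv_snd]; push_cast; rw [hj]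
    · rw [inv_trd]; push_cast; rw [hi, hj, hk]

theorem mem_integral {a : Heis} : a ∈ integral ↔ (∃ k : ℤ, (k : ℝ) = a.1) ∧
    (∃ k : ℤ, (k : ℝ) = a.2.1) ∧ ∃ k : ℤ, (k : ℝ) = a.2.2 := Iff.rfl

theorem isDiscrete_integral : IsDiscrete (integral : Set Heis) := by
  refine ⟨discreteTopology_of_isOpen_singleton_one (G := integral) ?_⟩
  rw [isOpen_induced_iff]
  refine ⟨{a : ℝ × ℝ × ℝ | |a.1| < 1 ∧ |a.2.1| < 1 ∧ |a.2.2| < 1}, ?_, ?_⟩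
  · have h1 : Continuous fun a : ℝ × ℝ × ℝ => |a.1| := by fun_prop
    have h2 : Continuous fun a : ℝ × ℝ × ℝ => |a.2.1| := by fun_prop
    have h3 : Continuous fun a : ℝ × ℝ × ℝ => |a.2.2| := by fun_prop
    exact (isOpen_lt h1 continuous_const).inter
      ((isOpen_lt h2 continuous_const).inter (isOpen_lt h3 continuous_const))
  · have key : ∀ x : ℝ, (∃ k : ℤ, (k : ℝ) = x) → |x| < 1 → x = 0 := by
      rintro _ ⟨k, rfl⟩ h
      rw [← Int.cast_abs] at h
      have : |k| < 1 := by exact_mod_cast h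
      rw [Int.abs_lt_one_iff.1 this, Int.cast_zero]
    ext ⟨a, h1, h2, h3⟩
    simp only [Set.mem_preimage, Set.mem_singleton_iff]
    constructor
    · rintro ⟨k1, k2, k3⟩
      exact Subtype.ext (ext (key _ h1 k1) (key _ h2 k2) (key _ h3 k3))
    · intro h
      obtain rfl : a = 1 := congrArg Subtype.val h
      exact ⟨by simp [one_fst], by simp [one_snd], by simp [one_trd]⟩

/-- The projection to the Heisenberg nilmanifold. -/
abbrev proj : Heis → Heis ⧸ integral := QuotientGroup.mk

theorem isQuotientCoveringMap_proj : IsQuotientCoveringMap proj integral.op :=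
  Subgroup.isQuotientCoveringMap integral isDiscrete_integral

/-- The inverse of the identification of the deck group with the integral subgroup. -/
def deckHom : (integral.op)ᵐᵒᵖ →* Heis where
  toFun x := MulOpposite.unop (MulOpposite.unop x).1
  map_one' := rfl
  map_mul' _ _ := rfl

/-- The fundamental group of the Heisenberg nilmanifold acts on the fibre: the end point of the
lift of a loop. -/
def monodromyHom : FundamentalGroup (Heis ⧸ integral) (proj 1) →* Heis :=
  deckHom.comp (isQuotientCoveringMap_proj.fundamentalGroupToMulOpposite ⟨1, rfl⟩)

theorem monodromyHom_mk (γ : Path (proj 1) (proj 1)) (Γ : C(unitInterval, Heis))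
    (h : ∀ t, proj (Γ t) = γ t) (h0 : Γ 0 = 1) :
    monodromyHom (FundamentalGroup.fromPath (Path.Homotopic.Quotient.mk γ)) = Γ 1 := by
  have h1 := (isQuotientCoveringMap_proj.fundamentalGroupToMulOpposite_apply_eq_Iff
    (e := ⟨1, rfl⟩) (γ := FundamentalGroup.fromPath (Path.Homotopic.Quotient.mk γ))).1 rfl
  have h2 : Γ = isQuotientCoveringMap_proj.isCoveringMap.liftPath γ 1 γ.source :=
    (isQuotientCoveringMap_proj.isCoveringMap.eq_liftPath_iff' _).2 ⟨funext h, h0⟩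
  rw [h2]
  refine Eq.trans ?_ h1
  -- The deck group acts by right multiplication, so applied to the base point `1` an element
  -- returns itself.
  exact (one_mul _).symm

theorem proj_eq_iff {a b : Heis} : proj a = proj b ↔ a⁻¹ * b ∈ integral := QuotientGroup.eq

end Heis

/-! ### Angles -/

theorem exists_phi_eq {n : ℕ} (hn : 1 ≤ n) {h : Hawaiian} (hh : h.point ∈ circle n) :
    ∃ t ∈ Set.Icc (0 : ℝ) 1, phi n t = h := by
  have hn' : (n : ℝ) ≠ 0 := by positivity
  have h1 := (mem_circle_iff n h.point).1 hh
  rw [EuclideanSpace.norm_sq_eq, Fin.sum_univ_two, Real.norm_eq_abs, Real.norm_eq_abs, sq_abs,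
    sq_abs] at h1
  set x := h.point 0 with hx
  set y := h.point 1 with hy
  -- Rescaling the circle to the unit circle turns `phi n t` into `exp (2πit)`, so the parameter is
  -- the argument divided by `2π`, taken modulo one.
  let z : ℂ := ⟨1 - n * x, n * y⟩
  have hz : ‖z‖ = 1 := by
    rw [← sq_eq_sq₀ (norm_nonneg z) zero_le_one, ← Complex.normSq_eq_norm_sq, Complex.normSq_mk]
    field_simp at h1
    linear_combination (n : ℝ) * h1
  have hz0 : z ≠ 0 := by
    rw [← norm_ne_zero_iff, hz]
    exact one_ne_zero
  have hc := Complex.cos_arg hz0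
  have hs := Complex.sin_arg z
  rw [hz, div_one] at hc hs
  refine ⟨Int.fract (z.arg / (2 * Real.pi)), ⟨Int.fract_nonneg _, (Int.fract_lt_one _).le⟩, ?_⟩
  have e : 2 * Real.pi * Int.fract (z.arg / (2 * Real.pi)) =
      z.arg - ⌊z.arg / (2 * Real.pi)⌋ * (2 * Real.pi) := by
    rw [Int.fract]
    have := Real.pi_ne_zero
    field_simp
  ext i
  fin_cases i
  · simp only [phi, e, Real.cos_sub_int_mul_two_pi, hc, z]
    simp
    field_simp
    ring
  · simp only [phi, e, Real.sin_sub_int_mul_two_pi, hs, z]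
    simp
    field_simp
    rfl

theorem phi_eq_phi {n : ℕ} (hn : 1 ≤ n) {s t : ℝ} (h : phi n s = phi n t) :
    ∃ k : ℤ, (k : ℝ) = s - t := by
  have hn' : (n : ℝ) ≠ 0 := by positivity
  have h0 := congrArg (fun h => Hawaiian.point h 0) h
  have h1 := congrArg (fun h => Hawaiian.point h 1) h
  simp [phi] at h0 h1
  obtain ⟨k, hk⟩ := Real.Angle.angle_eq_iff_two_pi_dvd_sub.1
    (Real.Angle.cos_sin_inj ((div_left_inj' hn').1 h0) ((div_left_inj' hn').1 h1))
  refine ⟨k, ?_⟩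
  have : 2 * Real.pi * (s - t - k) = 0 := by linear_combination hk
  rcases mul_eq_zero.1 this with h | h
  · exact absurd h (by positivity)
  · linarith

open Classical in
/-- The parameter of a point on the `n`-th circle; zero for points outside of that circle. -/
def angle (n : ℕ) (h : Hawaiian) : ℝ :=
  if hh : ∃ t ∈ Set.Icc (0 : ℝ) 1, phi n t = h then hh.choose else 0

theorem phi_angle {n : ℕ} (hn : 1 ≤ n) {h : Hawaiian} (hh : h.point ∈ circle n) :
    phi n (angle n h) = h := by
  have hex := exists_phi_eq hn hh
  rw [angle, dif_pos hex]
  exact hex.choose_spec.2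

theorem angle_of_notMem {n : ℕ} (hn : 1 ≤ n) {h : Hawaiian} (hh : h.point ∉ circle n) :
    angle n h = 0 := by
  rw [angle, dif_neg]
  rintro ⟨t, -, rfl⟩
  exact hh (phi_mem_circle hn t)

theorem exists_int_angle_phi {n : ℕ} (hn : 1 ≤ n) (t : ℝ) :
    ∃ k : ℤ, (k : ℝ) = angle n (phi n t) - t :=
  phi_eq_phi hn (phi_angle hn (phi_mem_circle hn t))

/-- The parameter chosen for the origin may be `0` or `1`; only its class modulo the integers is
determined. -/
theorem exists_int_angle_origin {n : ℕ} (hn : 1 ≤ n) : ∃ k : ℤ, (k : ℝ) = angle n origin := by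
  have := exists_int_angle_phi hn 0
  rwa [phi_zero, sub_zero] at this

theorem eq_origin_of_mem_circle {m n : ℕ} (hm : 1 ≤ m) (hn : 1 ≤ n) (hmn : m ≠ n) {h : Hawaiian}
    (h1 : h.point ∈ circle m) (h2 : h.point ∈ circle n) : h = origin :=
  Hawaiian.ext (eq_zero_of_mem_circle hm hn hmn h1 h2)

/-- A point not on a common circle with `h` has distance at least `‖h‖` from it, and so has the
origin; the ball of radius `‖h‖` therefore stays in the punctured circle. -/
theorem isOpen_circle_diff_origin {n : ℕ} (hn : 1 ≤ n) :
    IsOpen {h : Hawaiian | h.point ∈ circle n ∧ h ≠ origin} := by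
  rw [Metric.isOpen_iff]
  rintro h ⟨h1, h2⟩
  have h3 : 0 < ‖h.point‖ := norm_pos_iff.2 fun h3 => h2 (Hawaiian.ext h3)
  refine ⟨‖h.point‖, h3, fun x hx => ?_⟩
  rw [Metric.mem_ball] at hx
  have hs : SameCircle x h := by
    by_contra hs
    rw [dist_of_not_same hs] at hx
    linarith [norm_nonneg x.point]
  constructor
  · obtain ⟨m, hm, k1, k2⟩ := hs
    by_cases hmn : m = n
    · exact hmn ▸ k1
    · exact absurd (eq_origin_of_mem_circle hm hn hmn k2 h1) h2
  · rintro rfl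
    rw [dist_of_same hs] at hx
    simp [origin] at hx

instance : PathConnectedSpace Hawaiian where
  nonempty := ⟨origin⟩
  joined := by
    have key : ∀ h : Hawaiian, Joined origin h := by
      intro h
      obtain ⟨n, hn, hh⟩ := h.mem
      obtain ⟨t, -, rfl⟩ := exists_phi_eq hn hh
      have := JoinedIn.joined (((isPathConnected_univ (X := ℝ)).joinedIn 0 trivial t trivial))
      rw [← phi_zero n]
      exact this.map (lipschitzWith_phi hn).continuous
    exact fun x y => (key x).symm.trans (key y)

/-! ### The homomorphisms to the Heisenberg group -/

section

variable {p q : ℕ}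

/-- The map from the Hawaiian earring to the Heisenberg nilmanifold that wraps the `p`-th and the
`q`-th circle around the two generating circles and collapses the other circles. -/
def toNil (p q : ℕ) (h : Hawaiian) : Heis ⧸ Heis.integral :=
  Heis.proj (Heis.mk (angle p h) (angle q h) 0)

/-- The third coordinate of the quotient of the two elements is `a * (b - b')`. Noncommutativity
makes the last condition necessary: integrality of `a - a'` and `b - b'` alone does not suffice. -/
theorem proj_eq_proj {a b a' b' : ℝ} (ha : ∃ k : ℤ, (k : ℝ) = a - a') (hb : ∃ k : ℤ, (k : ℝ) = b - b')
    (h : (∃ k : ℤ, (k : ℝ) = a) ∨ b = b') :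
    Heis.proj (Heis.mk a b 0) = Heis.proj (Heis.mk a' b' 0) := by
  obtain ⟨i, hi⟩ := ha
  obtain ⟨j, hj⟩ := hb
  rw [Heis.proj_eq_iff, Heis.mem_integral, Heis.mul_fst, Heis.mul_snd, Heis.mul_trd, Heis.inv_fst,
    Heis.inv_snd, Heis.inv_trd]
  refine ⟨⟨-i, ?_⟩, ⟨-j, ?_⟩, ?_⟩
  · push_cast; rw [hi]; show _ = -a + a'; ring
  · push_cast; rw [hj]; show _ = -b + b'; ring
  · show ∃ k : ℤ, (k : ℝ) = -0 + a * b + 0 + -a * b'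
    rcases h with ⟨k, hk⟩ | rfl
    · refine ⟨k * j, ?_⟩
      push_cast
      rw [hk, hj]
      ring
    · exact ⟨0, by push_cast; ring⟩

theorem toNil_origin (hp : 1 ≤ p) (hq : 1 ≤ q) : toNil p q origin = Heis.proj 1 := by
  refine proj_eq_proj ?_ ?_ (Or.inl (exists_int_angle_origin hp))
  · rw [sub_zero]
    exact exists_int_angle_origin hp
  · rw [sub_zero]
    exact exists_int_angle_origin hq

theorem toNil_of_notMem (hp : 1 ≤ p) (hq : 1 ≤ q) {h : Hawaiian}
    (h1 : h.point ∉ circle p ∨ h = origin) (h2 : h.point ∉ circle q ∨ h = origin) :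
    toNil p q h = Heis.proj 1 := by
  by_cases h0 : h = origin
  · rw [h0, toNil_origin hp hq]
  · rw [toNil, angle_of_notMem hp (h1.resolve_right h0), angle_of_notMem hq (h2.resolve_right h0)]
    rfl

theorem toNil_phi_left (hp : 1 ≤ p) (hq : 1 ≤ q) (hpq : p ≠ q) (t : ℝ) :
    toNil p q (phi p t) = Heis.proj (Heis.mk t 0 0) := by
  by_cases h : (phi p t).point ∈ circle q
  · have h0 := eq_origin_of_mem_circle hp hq hpq (phi_mem_circle hp t) h
    have h1 := exists_int_angle_phi hp t
    rw [h0] at h1 ⊢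
    refine proj_eq_proj h1 ?_ (Or.inl (exists_int_angle_origin hp))
    rw [sub_zero]
    exact exists_int_angle_origin hq
  · refine proj_eq_proj (exists_int_angle_phi hp t) ?_ (Or.inr (angle_of_notMem hq h))
    rw [angle_of_notMem hq h]
    exact ⟨0, by simp⟩

theorem toNil_phi_right (hp : 1 ≤ p) (hq : 1 ≤ q) (hpq : p ≠ q) (t : ℝ) :
    toNil p q (phi q t) = Heis.proj (Heis.mk 0 t 0) := by
  have h : ∃ k : ℤ, (k : ℝ) = angle p (phi q t) := by
    by_cases h : (phi q t).point ∈ circle p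
    · rw [eq_origin_of_mem_circle hp hq hpq h (phi_mem_circle hq t)]
      exact exists_int_angle_origin hp
    · rw [angle_of_notMem hp h]
      exact ⟨0, by simp⟩
  refine proj_eq_proj ?_ (exists_int_angle_phi hq t) (Or.inl h)
  rwa [sub_zero]

theorem phi_notMem_or_eq_origin {m n : ℕ} (hn : 1 ≤ n) (hm : 1 ≤ m) (hnm : n ≠ m) (t : ℝ) :
    (phi n t).point ∉ circle m ∨ phi n t = origin := by
  by_cases h : (phi n t).point ∈ circle m
  · exact Or.inr (eq_origin_of_mem_circle hn hm hnm (phi_mem_circle hn t) h)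
  · exact Or.inl h

theorem continuous_toNil (hp : 1 ≤ p) (hq : 1 ≤ q) (hpq : p ≠ q) : Continuous (toNil p q) := by
  have hc : Continuous Heis.proj := continuous_quotient_mk'
  have c1 : Continuous fun t : ℝ => Heis.proj (Heis.mk t 0 0) :=
    hc.comp (show Continuous fun t : ℝ => ((t, 0, 0) : ℝ × ℝ × ℝ) by fun_prop)
  have c2 : Continuous fun t : ℝ => Heis.proj (Heis.mk 0 t 0) :=
    hc.comp (show Continuous fun t : ℝ => ((0, t, 0) : ℝ × ℝ × ℝ) by fun_prop)
  rw [continuous_iff_isClosed]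
  intro C hC
  -- Each of the two circles contributes a compact image; off the two open punctured circles the map
  -- is constant, so the remaining piece is closed too.
  have e : toNil p q ⁻¹' C =
      phi p '' (Set.Icc 0 1 ∩ (fun t : ℝ => Heis.proj (Heis.mk t 0 0)) ⁻¹' C) ∪
      phi q '' (Set.Icc 0 1 ∩ (fun t : ℝ => Heis.proj (Heis.mk 0 t 0)) ⁻¹' C) ∪
      ({h | h.point ∈ circle p ∧ h ≠ origin}ᶜ ∩ {h | h.point ∈ circle q ∧ h ≠ origin}ᶜ ∩
        {_h | Heis.proj 1 ∈ C}) := by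
    ext h
    constructor
    · intro hh
      by_cases h1 : h.point ∈ circle p ∧ h ≠ origin
      · obtain ⟨t, ht, rfl⟩ := exists_phi_eq hp h1.1
        refine Or.inl (Or.inl ⟨t, ⟨ht, ?_⟩, rfl⟩)
        rwa [Set.mem_preimage, toNil_phi_left hp hq hpq] at hh
      · by_cases h2 : h.point ∈ circle q ∧ h ≠ origin
        · obtain ⟨t, ht, rfl⟩ := exists_phi_eq hq h2.1
          refine Or.inl (Or.inr ⟨t, ⟨ht, ?_⟩, rfl⟩)
          rwa [Set.mem_preimage, toNil_phi_right hp hq hpq] at hh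
        · refine Or.inr ⟨⟨h1, h2⟩, ?_⟩
          rw [Set.mem_preimage, toNil_of_notMem hp hq (by tauto) (by tauto)] at hh
          exact hh
    · rintro ((⟨t, ⟨-, ht⟩, rfl⟩ | ⟨t, ⟨-, ht⟩, rfl⟩) | ⟨⟨h1, h2⟩, h3⟩)
      · rw [Set.mem_preimage, toNil_phi_left hp hq hpq]
        exact ht
      · rw [Set.mem_preimage, toNil_phi_right hp hq hpq]
        exact ht
      · simp only [Set.mem_compl_iff, Set.mem_ofPred_eq] at h1 h2
        rw [Set.mem_preimage, toNil_of_notMem hp hq (by tauto) (by tauto)]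
        exact h3
  rw [e]
  refine IsClosed.union (IsClosed.union ?_ ?_) (IsClosed.inter (IsClosed.inter ?_ ?_) ?_)
  · exact ((isCompact_Icc.inter_right (hC.preimage c1)).image
      (lipschitzWith_phi hp).continuous).isClosed
  · exact ((isCompact_Icc.inter_right (hC.preimage c2)).image
      (lipschitzWith_phi hq).continuous).isClosed
  · exact (isOpen_circle_diff_origin hp).isClosed_compl
  · exact (isOpen_circle_diff_origin hq).isClosed_compl
  · exact isClosed_const

/-- The homomorphism from the fundamental group of the Hawaiian earring to the Heisenberg group
given by a pair of circles. -/
def heisHom (hp : 1 ≤ p) (hq : 1 ≤ q) (hpq : p ≠ q) : FundamentalGroup Hawaiian origin →* Heis :=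
  Heis.monodromyHom.comp (FundamentalGroup.mapOfEq ⟨toNil p q, continuous_toNil hp hq hpq⟩
    (toNil_origin hp hq))

theorem heisHom_mk (hp : 1 ≤ p) (hq : 1 ≤ q) (hpq : p ≠ q) (γ : Path origin origin)
    (Γ : C(unitInterval, Heis)) (h : ∀ t, Heis.proj (Γ t) = toNil p q (γ t)) (h0 : Γ 0 = 1) :
    heisHom hp hq hpq (FundamentalGroup.fromPath (Path.Homotopic.Quotient.mk γ)) = Γ 1 := by
  refine Eq.trans ?_ (Heis.monodromyHom_mk ((γ.map (continuous_toNil hp hq hpq)).cast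
    (toNil_origin hp hq).symm (toNil_origin hp hq).symm) Γ h h0)
  rw [heisHom, MonoidHom.comp_apply, FundamentalGroup.mapOfEq_apply]
  rfl

theorem exists_lift (hp : 1 ≤ p) (hq : 1 ≤ q) (hpq : p ≠ q) (γ : Path origin origin) :
    ∃ Γ : C(unitInterval, Heis), (∀ t, Heis.proj (Γ t) = toNil p q (γ t)) ∧ Γ 0 = 1 := by
  obtain ⟨Γ, h1, h2⟩ := Heis.isQuotientCoveringMap_proj.isCoveringMap.exists_path_lifts
    ⟨fun t => toNil p q (γ t), (continuous_toNil hp hq hpq).comp γ.continuous⟩ 1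
    (by simpa using toNil_origin hp hq)
  exact ⟨Γ, fun t => congrFun h1 t, h2⟩

theorem exists_int_of_proj_eq_toNil {a : Heis} {h : Hawaiian} (e : Heis.proj a = toNil p q h) :
    (∃ k : ℤ, (k : ℝ) = a.1 - angle p h) ∧ ∃ k : ℤ, (k : ℝ) = a.2.1 - angle q h := by
  rw [toNil, Heis.proj_eq_iff, Heis.mem_integral] at e
  obtain ⟨⟨i, hi⟩, ⟨j, hj⟩, -⟩ := e
  rw [Heis.mul_fst, Heis.inv_fst] at hi
  rw [Heis.mul_snd, Heis.inv_snd] at hj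
  refine ⟨⟨-i, ?_⟩, ⟨-j, ?_⟩⟩
  · push_cast
    rw [hi]
    show -(-a.1 + angle p h) = _
    ring
  · push_cast
    rw [hj]
    show -(-a.2.1 + angle q h) = _
    ring

/-- The difference is continuous and integer-valued on a connected space, hence constant. -/
theorem eq_of_int_sub {f g : unitInterval → ℝ} (hf : Continuous f) (hg : Continuous g)
    (h : ∀ t, ∃ k : ℤ, (k : ℝ) = f t - g t) (h0 : f 0 = g 0) : f 1 = g 1 := by
  have hd : IsDiscrete (Set.range ((↑) : ℤ → ℝ)) :=
    ⟨(Int.isClosedEmbedding_coe_real.isEmbedding.toHomeomorph).symm.isEmbedding.discreteTopology⟩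
  have := isPreconnected_univ.constant_of_mapsTo hd (hf.sub hg).continuousOn (fun t _ => h t)
    (Set.mem_univ (0 : unitInterval)) (Set.mem_univ (1 : unitInterval))
  simp only [Pi.sub_apply] at this
  linarith

/-- The winding number around the `n`-th circle. -/
def winding {n : ℕ} (hn : 1 ≤ n) (x : FundamentalGroup Hawaiian origin) : ℝ :=
  (heisHom hn (Nat.le_succ_of_le hn) (Nat.succ_ne_self n).symm x).1

theorem continuous_fst_heis : Continuous fun a : Heis => a.1 :=
  (continuous_fst : Continuous fun a : ℝ × ℝ × ℝ => a.1)

theorem continuous_snd_heis : Continuous fun a : Heis => a.2.1 :=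
  (continuous_fst.comp continuous_snd : Continuous fun a : ℝ × ℝ × ℝ => a.2.1)

/-- The partner `p + 1` in the definition of `winding` is immaterial: for either partner, the first
coordinate of the lift is congruent to the `p`-angle modulo the integers and starts at `0`. -/
theorem heisHom_fst (hp : 1 ≤ p) (hq : 1 ≤ q) (hpq : p ≠ q)
    (x : FundamentalGroup Hawaiian origin) : (heisHom hp hq hpq x).1 = winding hp x := by
  obtain ⟨γ, rfl⟩ := Path.Homotopic.Quotient.mk_surjective x
  obtain ⟨Γ, h1, h2⟩ := exists_lift hp hq hpq γ
  obtain ⟨Δ, h3, h4⟩ := exists_lift hp (Nat.le_succ_of_le hp) (Nat.succ_ne_self p).symm γ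
  refine (congrArg (fun a : Heis => a.1) (heisHom_mk hp hq hpq γ Γ h1 h2)).trans
    (Eq.trans ?_ (congrArg (fun a : Heis => a.1) (heisHom_mk _ _ _ γ Δ h3 h4)).symm)
  refine eq_of_int_sub (continuous_fst_heis.comp Γ.continuous)
    (continuous_fst_heis.comp Δ.continuous) (fun t => ?_) ?_
  · obtain ⟨i, hi⟩ := (exists_int_of_proj_eq_toNil (h1 t)).1
    obtain ⟨j, hj⟩ := (exists_int_of_proj_eq_toNil (h3 t)).1
    refine ⟨i - j, ?_⟩
    push_cast
    rw [hi, hj]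
    show _ = (Γ t).1 - (Δ t).1
    ring
  · show (Γ 0).1 = (Δ 0).1
    rw [h2, h4]

theorem heisHom_snd (hp : 1 ≤ p) (hq : 1 ≤ q) (hpq : p ≠ q)
    (x : FundamentalGroup Hawaiian origin) : (heisHom hp hq hpq x).2.1 = winding hq x := by
  obtain ⟨γ, rfl⟩ := Path.Homotopic.Quotient.mk_surjective x
  obtain ⟨Γ, h1, h2⟩ := exists_lift hp hq hpq γ
  obtain ⟨Δ, h3, h4⟩ := exists_lift hq (Nat.le_succ_of_le hq) (Nat.succ_ne_self q).symm γ
  refine (congrArg (fun a : Heis => a.2.1) (heisHom_mk hp hq hpq γ Γ h1 h2)).trans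
    (Eq.trans ?_ (congrArg (fun a : Heis => a.1) (heisHom_mk _ _ _ γ Δ h3 h4)).symm)
  refine eq_of_int_sub (continuous_snd_heis.comp Γ.continuous)
    (continuous_fst_heis.comp Δ.continuous) (fun t => ?_) ?_
  · obtain ⟨i, hi⟩ := (exists_int_of_proj_eq_toNil (h1 t)).2
    obtain ⟨j, hj⟩ := (exists_int_of_proj_eq_toNil (h3 t)).1
    refine ⟨i - j, ?_⟩
    push_cast
    rw [hi, hj]
    show _ = (Γ t).2.1 - (Δ t).1
    ring
  · show (Γ 0).2.1 = (Δ 0).1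
    rw [h2, h4]
    rfl

theorem winding_mul {n : ℕ} (hn : 1 ≤ n) (x y : FundamentalGroup Hawaiian origin) :
    winding hn (x * y) = winding hn x + winding hn y := by
  rw [winding, map_mul, Heis.mul_fst]
  rfl

theorem winding_inv {n : ℕ} (hn : 1 ≤ n) (x : FundamentalGroup Hawaiian origin) :
    winding hn x⁻¹ = -winding hn x := by
  rw [winding, map_inv, Heis.inv_fst]
  rfl

theorem winding_one {n : ℕ} (hn : 1 ≤ n) : winding hn 1 = 0 := by
  rw [winding, map_one, Heis.one_fst]

/-! ### The commutator subgroup -/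

open scoped commutatorElement in
-- In a commutator the third coordinates of the factors cancel and only the determinant of the
-- winding numbers is left.
theorem heisHom_commutatorElement (hp : 1 ≤ p) (hq : 1 ≤ q) (hpq : p ≠ q)
    (x y : FundamentalGroup Hawaiian origin) :
    (heisHom hp hq hpq ⁅x, y⁆).2.2 = winding hp x * winding hq y - winding hp y * winding hq x := by
  rw [commutatorElement_def, map_mul, map_mul, map_mul, map_inv, map_inv]
  simp only [Heis.mul_fst, Heis.mul_trd, Heis.inv_fst, Heis.inv_snd, Heis.inv_trd,
    heisHom_fst, heisHom_snd]
  ring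

/-- The matrix of areas of an element of the commutator subgroup has finite rank. -/
theorem exists_finiteDimensional_of_mem_commutator {a b : ℕ → ℕ} (ha : ∀ i, 1 ≤ a i)
    (hb : ∀ i, 1 ≤ b i) (hab : ∀ i j, a i ≠ b j) {x : FundamentalGroup Hawaiian origin}
    (hx : x ∈ commutator (FundamentalGroup Hawaiian origin)) :
    ∃ V : Submodule ℝ (ℕ → ℝ), FiniteDimensional ℝ V ∧
      ∀ i, (fun j => (heisHom (ha i) (hb j) (hab i j) x).2.2) ∈ V := by
  -- Vanishing of the winding numbers is carried through the induction: it kills the cross term in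
  -- the Heisenberg product, so areas add and the row spaces can simply be summed.
  suffices h : (∀ (n : ℕ) (hn : 1 ≤ n), winding hn x = 0) ∧
      ∃ V : Submodule ℝ (ℕ → ℝ), FiniteDimensional ℝ V ∧
        ∀ i, (fun j => (heisHom (ha i) (hb j) (hab i j) x).2.2) ∈ V from h.2
  rw [commutator_eq_closure] at hx
  induction hx using Subgroup.closure_induction with
  | mem x hx =>
    obtain ⟨y, z, rfl⟩ := hx
    -- Every row of the matrix of a commutator is a combination of the winding vectors of its two
    -- entries.
    refine ⟨fun n hn => ?_, Submodule.span ℝ {fun j => winding (hb j) y, fun j => winding (hb j) z},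
      FiniteDimensional.span_of_finite ℝ (Set.toFinite _), fun i => ?_⟩
    · rw [commutatorElement_def, winding_mul, winding_mul, winding_mul, winding_inv, winding_inv]
      ring
    · rw [Submodule.mem_span_pair]
      refine ⟨-winding (ha i) z, winding (ha i) y, ?_⟩
      funext j
      rw [heisHom_commutatorElement]
      simp only [Pi.add_apply, Pi.smul_apply, smul_eq_mul]
      ring
  | one =>
    refine ⟨fun n hn => winding_one hn, ⊥, inferInstance, fun i => ?_⟩
    rw [Submodule.mem_bot]
    funext j
    rw [map_one]
    rfl
  | mul x y _ _ hx hy =>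
    obtain ⟨hx, V, hV, hV'⟩ := hx
    obtain ⟨hy, W, hW, hW'⟩ := hy
    refine ⟨fun n hn => by rw [winding_mul, hx, hy, add_zero], V ⊔ W, inferInstance, fun i => ?_⟩
    convert Submodule.add_mem_sup (hV' i) (hW' i) using 1
    funext j
    rw [map_mul, Heis.mul_trd, heisHom_fst, hx, zero_mul, add_zero]
    rfl
  | inv x _ hx =>
    obtain ⟨hx, V, hV, hV'⟩ := hx
    refine ⟨fun n hn => by rw [winding_inv, hx, neg_zero], V, hV, fun i => ?_⟩
    convert V.neg_mem (hV' i) using 1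
    funext j
    rw [map_inv, Heis.inv_trd, heisHom_fst, hx, zero_mul, add_zero]
    rfl

end

/-! ### The image of `σ₁` under the homomorphisms to the Heisenberg group -/

theorem Heis.pow_center (z : ℝ) (n : ℕ) : (Heis.mk 0 0 z) ^ n = Heis.mk 0 0 (n * z) := by
  induction n with
  | zero =>
    rw [pow_zero, Nat.cast_zero, zero_mul]
    rfl
  | succ n ih =>
    rw [pow_succ, ih]
    apply Heis.ext
    · exact add_zero _
    · exact add_zero _
    · rw [Heis.mul_trd]
      simp only [Heis.mk_fst, Heis.mk_trd]
      push_cast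
      ring

section

variable {p q : ℕ} (hp : 1 ≤ p) (hq : 1 ≤ q) (hpq : p ≠ q)

/-- The invariant of loops given by a pair of circles. -/
abbrev heisInvariant : LoopInvariant origin Heis := pi1Invariant origin (heisHom hp hq hpq)

theorem phiVal_eq {n : ℕ} (hn : 1 ≤ n) (Γ : ℝ → Heis) (hΓ : Continuous Γ) (h0 : Γ 0 = 1)
    (h : ∀ t, Heis.proj (Γ t) = toNil p q (phi n t)) :
    (heisInvariant hp hq hpq).phiVal n hn = Γ 1 := by
  refine heisHom_mk hp hq hpq _ ⟨fun t : unitInterval => Γ t, hΓ.comp continuous_subtype_val⟩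
    (fun t => ?_) h0
  refine (h t).trans (congrArg (toNil p q) ?_)
  show phi n t = phi n (0 + (1 - 0) * (1 * t))
  congr 1
  ring

theorem phiVal_left : (heisInvariant hp hq hpq).phiVal p hp = Heis.mk 1 0 0 :=
  phiVal_eq hp hq hpq hp (fun t => Heis.mk t 0 0)
    (show Continuous fun t : ℝ => ((t, 0, 0) : ℝ × ℝ × ℝ) by fun_prop) rfl
    fun t => (toNil_phi_left hp hq hpq t).symm

theorem phiVal_right : (heisInvariant hp hq hpq).phiVal q hq = Heis.mk 0 1 0 :=
  phiVal_eq hp hq hpq hq (fun t => Heis.mk 0 t 0)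
    (show Continuous fun t : ℝ => ((0, t, 0) : ℝ × ℝ × ℝ) by fun_prop) rfl
    fun t => (toNil_phi_right hp hq hpq t).symm

theorem phiVal_of_ne {n : ℕ} (hn : 1 ≤ n) (hnp : n ≠ p) (hnq : n ≠ q) :
    (heisInvariant hp hq hpq).phiVal n hn = 1 :=
  phiVal_eq hp hq hpq hn (fun _ => 1) continuous_const rfl
    fun t => (toNil_of_notMem hp hq (phi_notMem_or_eq_origin hn hp hnp t)
      (phi_notMem_or_eq_origin hn hq hnq t)).symm

variable {N : ℕ → ℕ} {σ : Set.Icc (0 : ℝ) 1 → Hawaiian}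

/-- The loop meets the circles `p` and `q` in the origin at most, so `toNil` is constant along it
and the constant path `1` is a lift. -/
theorem val_sigma_eq_one (h : IsSigmaOne N σ) {n : ℕ} (hn : 1 ≤ n) (hN : ∀ k, n ≤ k → 1 ≤ N k)
    (hk : ∀ k, n ≤ k → N k ≠ p ∧ N k ≠ q ∧ N k + 1 ≠ p ∧ N k + 1 ≠ q) :
    (heisInvariant hp hq hpq).val (h.isLipschitzLoop_sigma hn) = 1 := by
  refine heisHom_mk hp hq hpq _ (ContinuousMap.const _ 1) (fun t => ?_) rfl
  have hs : List.replicate n 1 ∈ seqB := replicate_mem_seqB hn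
  -- The complement of the two punctured circles is closed and contains all circles used from level
  -- `n` on.
  have hZ := (isOpen_circle_diff_origin hp).isClosed_compl.inter
    (isOpen_circle_diff_origin hq).isClosed_compl
  have hmem : ∀ h : Hawaiian, h ∈ {h : Hawaiian | h.point ∈ circle p ∧ h ≠ origin}ᶜ ∩
      {h | h.point ∈ circle q ∧ h ≠ origin}ᶜ ↔
      (h.point ∉ circle p ∨ h = origin) ∧ (h.point ∉ circle q ∨ h = origin) := by
    intro h
    simp only [Set.mem_inter_iff, Set.mem_compl_iff, Set.mem_ofPred_eq]
    tauto
  have hl := lam_pos n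
  have h1 := h.extend_mem hs hZ (fun k hk' t => by
      rw [List.length_replicate] at hk'
      obtain ⟨h1, h2, h3, h4⟩ := hk k hk'
      have h5 := hN k hk'
      have h6 : 1 ≤ N k + 1 := Nat.le_add_left 1 _
      rw [hmem, hmem]
      exact ⟨⟨phi_notMem_or_eq_origin h5 hp h1 t, phi_notMem_or_eq_origin h5 hq h2 t⟩,
        phi_notMem_or_eq_origin h6 hp h3 t, phi_notMem_or_eq_origin h6 hq h4 t⟩)
    (t := 2 * lam n * t) (by
      rw [List.length_replicate]
      exact ⟨mul_nonneg (by positivity) t.2.1, mul_le_of_le_one_right (by positivity) t.2.2⟩)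
  rw [hmem] at h1
  refine (Eq.trans (congrArg (toNil p q) ?_) (toNil_of_notMem hp hq h1.1 h1.2)).symm
  exact congrArg (Set.IccExtend zero_le_one σ) (add_comm (2 * lam n * (t : ℝ)) _)

end

/-! ### Separation of the circles of different levels -/

theorem Admissible.one_le {N : ℕ → ℕ} (hN : Admissible N) {k : ℕ} (hk : 1 ≤ k) : 1 ≤ N k :=
  (hN k hk).1

theorem Admissible.add_one_lt {N : ℕ → ℕ} (hN : Admissible N) {i j : ℕ} (hi : 1 ≤ i)
    (hij : i < j) : N i + 1 < N j := by
  induction j, hij using Nat.le_induction with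
  | base => exact (hN i hi).2.2
  | succ j hj ih =>
    have := (hN j (by omega)).2.2
    omega

theorem Admissible.eq_of_eq {N : ℕ → ℕ} (hN : Admissible N) {i j : ℕ} (hi : 1 ≤ i) (hj : 1 ≤ j)
    (h : N i = N j ∨ N i + 1 = N j + 1) : i = j := by
  rcases lt_trichotomy i j with h1 | h1 | h1
  · have := hN.add_one_lt hi h1
    omega
  · exact h1
  · have := hN.add_one_lt hj h1
    omega

theorem Admissible.ne_add_one {N : ℕ → ℕ} (hN : Admissible N) {i j : ℕ} (hi : 1 ≤ i)
    (hj : 1 ≤ j) : N i ≠ N j + 1 := by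
  rcases lt_trichotomy i j with h1 | rfl | h1
  · have := hN.add_one_lt hi h1
    omega
  · omega
  · have := hN.add_one_lt hj h1
    omega

section

variable {N : ℕ → ℕ} {σ : Set.Icc (0 : ℝ) 1 → Hawaiian} (hN : Admissible N) (h : IsSigmaOne N σ)

include hN

theorem exists_val_sigma_eq_one {i j : ℕ} (hi : 1 ≤ i) (hj : 1 ≤ j) :
    ∃ m, i < m ∧ ∀ (n : ℕ) (hn : 1 ≤ n), m ≤ n →
      (heisInvariant (hN.one_le hi) (Nat.le_add_left 1 (N j)) (hN.ne_add_one hi hj)).val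
        (h.isLipschitzLoop_sigma hn) = 1 := by
  refine ⟨i + j + 1, by omega, fun n hn hmn => ?_⟩
  refine val_sigma_eq_one _ _ _ h hn (fun k hk => hN.one_le (by omega)) fun k hk => ?_
  have h1 := hN.add_one_lt (j := k) hi (by omega)
  have h2 := hN.add_one_lt (j := k) hj (by omega)
  omega

/-- For circles of different levels the image of every `σ_n` is trivial. -/
theorem val_sigma_of_ne {i j : ℕ} (hi : 1 ≤ i) (hj : 1 ≤ j) (hij : i ≠ j) {n : ℕ} (hn : 1 ≤ n) :
    (heisInvariant (hN.one_le hi) (Nat.le_add_left 1 (N j)) (hN.ne_add_one hi hj)).val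
      (h.isLipschitzLoop_sigma hn) = 1 := by
  obtain ⟨m, -, hm⟩ := exists_val_sigma_eq_one hN h hi hj
  -- Descending induction on `n`, starting from the level `m` beyond which neither circle occurs.
  have key : ∀ (d n : ℕ) (hn : 1 ≤ n), m ≤ n + d →
      (heisInvariant (hN.one_le hi) (Nat.le_add_left 1 (N j)) (hN.ne_add_one hi hj)).val
        (h.isLipschitzLoop_sigma hn) = 1 := by
    intro d
    induction d with
    | zero => exact fun n hn hmn => hm n hn hmn
    | succ d ih =>
      intro n hn hmn
      rw [LoopInvariant.val_sigma _ h hn (hN.one_le hn) (Nat.le_add_left 1 _),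
        ih (n + 1) (Nat.le_succ_of_le hn) (by omega), one_pow, one_mul]
      -- Since `i ≠ j`, at least one of the two circles of level `n` is neither `p` nor `q`, so the
      -- commutator has a trivial entry.
      by_cases hni : n = i
      · rw [phiVal_of_ne (n := N n + 1) _ _ _ _ (hN.ne_add_one hi hn).symm
          fun e => hij (hni ▸ hN.eq_of_eq hn hj (Or.inr e)),
          inv_one, one_mul, mul_one, inv_mul_cancel]
      · rw [phiVal_of_ne (n := N n) _ _ _ _ (fun e => hni (hN.eq_of_eq hn hi (Or.inl e)))
          (hN.ne_add_one hn hj), inv_one, mul_one, mul_one, inv_mul_cancel]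
  exact key m n hn (Nat.le_add_left _ _)

/-- For the two circles of level `i` the image of `σ_n`, `n ≤ i`, is a nontrivial central
element. -/
theorem val_sigma_self {i : ℕ} (hi : 1 ≤ i) {n : ℕ} (hn : 1 ≤ n) (hni : n ≤ i) :
    ∃ z : ℝ, z ≠ 0 ∧
      (heisInvariant (hN.one_le hi) (Nat.le_add_left 1 (N i)) (hN.ne_add_one hi hi)).val
        (h.isLipschitzLoop_sigma hn) = Heis.mk 0 0 z := by
  obtain ⟨m, -, hm⟩ := exists_val_sigma_eq_one hN h hi hi
  have key : ∀ (d n : ℕ) (hn : 1 ≤ n), i < n → m ≤ n + d →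
      (heisInvariant (hN.one_le hi) (Nat.le_add_left 1 (N i)) (hN.ne_add_one hi hi)).val
        (h.isLipschitzLoop_sigma hn) = 1 := by
    intro d
    induction d with
    | zero => exact fun n hn _ hmn => hm n hn hmn
    | succ d ih =>
      intro n hn hin hmn
      rw [LoopInvariant.val_sigma _ h hn (hN.one_le hn) (Nat.le_add_left 1 _),
        ih (n + 1) (Nat.le_succ_of_le hn) (by omega) (by omega), one_pow, one_mul,
        phiVal_of_ne (n := N n) _ _ _ _ (fun e => hin.ne' (hN.eq_of_eq hn hi (Or.inl e)))
          (hN.ne_add_one hn hi), inv_one, mul_one, mul_one, inv_mul_cancel]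
  have key2 : ∀ (d n : ℕ) (hn : 1 ≤ n), n + d = i → ∃ z : ℝ, z ≠ 0 ∧
      (heisInvariant (hN.one_le hi) (Nat.le_add_left 1 (N i)) (hN.ne_add_one hi hi)).val
        (h.isLipschitzLoop_sigma hn) = Heis.mk 0 0 z := by
    intro d
    induction d with
    | zero =>
      intro n hn hnd
      obtain rfl : n = i := hnd
      -- At level `i` the commutator of the two generators appears, in reversed order; the deeper
      -- loops contribute nothing.
      refine ⟨-1, by norm_num, ?_⟩
      rw [LoopInvariant.val_sigma _ h hn (hN.one_le hn) (Nat.le_add_left 1 _),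
        key m (n + 1) (Nat.le_succ_of_le hn) (by omega) (by omega), one_pow, one_mul, phiVal_left,
        phiVal_right]
      apply Heis.ext <;>
        norm_num [Heis.mul_fst, Heis.mul_snd, Heis.mul_trd, Heis.inv_fst, Heis.inv_snd,
          Heis.inv_trd, Heis.mk_fst, Heis.mk_snd, Heis.mk_trd]
    | succ d ih =>
      intro n hn hnd
      obtain ⟨z, hz, e⟩ := ih (n + 1) (Nat.le_succ_of_le hn) (by omega)
      -- Below level `i` the commutator is trivial and the power `n + 1` multiplies the central
      -- coordinate.
      refine ⟨(n + 1 : ℕ) * z, mul_ne_zero (by positivity) hz, ?_⟩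
      have hni : n ≠ i := by omega
      rw [LoopInvariant.val_sigma _ h hn (hN.one_le hn) (Nat.le_add_left 1 _), e,
        phiVal_of_ne (n := N n) _ _ _ _ (fun e => hni (hN.eq_of_eq hn hi (Or.inl e)))
          (hN.ne_add_one hn hi),
        Heis.pow_center, inv_one, mul_one, mul_one, inv_mul_cancel, mul_one]
  exact key2 (i - n) n hn (by omega)

/-- The class of `σ₁` in the fundamental group is not a product of commutators. -/
theorem pi1Class_sigma_notMem_commutator :
    (h.isLipschitzLoop_sigma le_rfl).pi1Class ∉ commutator (FundamentalGroup Hawaiian origin) := by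
  intro hc
  obtain ⟨V, hV, hV'⟩ := exists_finiteDimensional_of_mem_commutator
    (a := fun i => N (i + 1)) (b := fun j => N (j + 1) + 1)
    (fun i => hN.one_le (Nat.le_add_left 1 i)) (fun j => Nat.le_add_left 1 _)
    (fun i j => hN.ne_add_one (Nat.le_add_left 1 i) (Nat.le_add_left 1 j)) hc
  -- Row `i` of the area matrix is a nonzero multiple of the `i`-th unit vector, so `V` would
  -- contain infinitely many independent vectors.
  have hs : ∀ i : ℕ, (Pi.single i 1 : ℕ → ℝ) ∈ V := by
    intro i
    obtain ⟨z, hz, e⟩ := val_sigma_self hN h (Nat.le_add_left 1 i) le_rfl (Nat.le_add_left 1 i)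
    convert V.smul_mem z⁻¹ (hV' i) using 1
    funext j
    rw [Pi.smul_apply, smul_eq_mul]
    by_cases hij : j = i
    · subst hij
      rw [Pi.single_eq_same]
      have e2 : _ = z := congrArg (fun a : Heis => a.2.2) e
      exact (inv_mul_cancel₀ hz).symm.trans (congrArg (z⁻¹ * ·) e2.symm)
    · rw [Pi.single_eq_of_ne hij]
      have e := val_sigma_of_ne hN h (Nat.le_add_left 1 i) (Nat.le_add_left 1 j)
        (by omega) le_rfl
      have e2 : _ = (0 : ℝ) := congrArg (fun a : Heis => a.2.2) e
      exact (mul_zero z⁻¹).symm.trans (congrArg (z⁻¹ * ·) e2.symm)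
  have hli : LinearIndependent ℝ fun i : ℕ => (⟨Pi.single i 1, hs i⟩ : V) :=
    LinearIndependent.of_comp V.subtype (Pi.linearIndependent_single_one ℕ ℝ)
  exact not_finite_iff_infinite.2 inferInstance hli.finite

/-! ### Divisibility of the class of `σ₁` -/

omit hN

/-- `σ_{n}` is homologous to `n + 1` times `σ_{n+1}`. -/
theorem h1LClass_sigma (hN : Admissible N) {n : ℕ} (hn : 1 ≤ n) :
    (h.isLipschitzLoop_sigma hn).h1LClass =
      (n + 1) • (h.isLipschitzLoop_sigma (Nat.le_succ_of_le hn)).h1LClass := by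
  have e := (h1LInvariant origin).val_sigma h hn (hN.one_le hn) (Nat.le_add_left 1 _)
  rw [mul_right_comm _ _ ((h1LInvariant origin).phiVal (N n) _), inv_mul_cancel_right,
    inv_mul_cancel, mul_one] at e
  exact congrArg Multiplicative.toAdd e

/-- The integer multiples of the `x n` form a subgroup, as any two of them are multiples of a common
later term. It is divisible because `x m = (m + 1) ⋯ (m + l) • x (m + l)`, and a product of `l`
consecutive integers is divisible by `l!`, hence by `l`. -/
theorem mem_maximalDivisible {A : Type*} [AddCommGroup A] (x : ℕ → A)
    (hx : ∀ n, 1 ≤ n → x n = (n + 1) • x (n + 1)) : x 1 ∈ maximalDivisible A := by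
  have h1 : ∀ m n : ℕ, 1 ≤ m → x m = (m + 1).ascFactorial n • x (m + n) := by
    intro m n hm
    induction n with
    | zero => simp
    | succ n ih =>
      rw [ih, hx (m + n) (by omega), smul_smul, Nat.ascFactorial_succ, mul_comm]
      congr 2
      ring
  let D : AddSubgroup A :=
    { carrier := {a | ∃ n, 1 ≤ n ∧ ∃ k : ℤ, a = k • x n}
      zero_mem' := ⟨1, le_rfl, 0, by simp⟩
      add_mem' := by
        rintro a b ⟨m, hm, k, rfl⟩ ⟨n, hn, l, rfl⟩
        refine ⟨m + n, by omega,
          k * (m + 1).ascFactorial n + l * (n + 1).ascFactorial m, ?_⟩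
        rw [add_smul, mul_smul, mul_smul, h1 m n hm, h1 n m hn, natCast_zsmul, natCast_zsmul,
          add_comm n m]
      neg_mem' := by
        rintro a ⟨m, hm, k, rfl⟩
        exact ⟨m, hm, -k, by simp⟩ }
  have hD : IsDivisible D := by
    rintro l hl _ ⟨m, hm, k, rfl⟩
    obtain ⟨c, hc⟩ : l ∣ (m + 1).ascFactorial l :=
      (Nat.dvd_factorial hl le_rfl).trans (Nat.factorial_dvd_ascFactorial (m + 1) l)
    refine ⟨(k * c) • x (m + l), ⟨m + l, by omega, _, rfl⟩, ?_⟩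
    rw [h1 m l hm, hc, ← natCast_zsmul, ← natCast_zsmul, smul_smul, smul_smul]
    congr 1
    push_cast
    ring
  exact (le_sSup hD : D ≤ maximalDivisible A) ⟨1, le_rfl, 1, by simp⟩

theorem map_mem_maximalDivisible {A B : Type*} [AddCommGroup A] [AddCommGroup B] (f : A →+ B)
    {a : A} (ha : a ∈ maximalDivisible A) : f a ∈ maximalDivisible B := by
  have hD : IsDivisible ((maximalDivisible A).map f) := by
    rintro l hl _ ⟨x, hx, rfl⟩
    obtain ⟨y, hy, rfl⟩ := (isGreatest_maximalDivisible A).1 l hl x hx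
    exact ⟨f y, ⟨y, hy, rfl⟩, (map_nsmul f l y).symm⟩
  exact (isGreatest_maximalDivisible B).2 hD ⟨a, ha, rfl⟩

theorem h1LClass_sigma_one_mem (hN : Admissible N) :
    (h.isLipschitzLoop_sigma le_rfl).h1LClass ∈ maximalDivisible (H1L Hawaiian) := by
  -- The value at `n = 0` is a filler; the recursion is needed for `n ≥ 1` only.
  refine mem_maximalDivisible
    (fun n => if hn : 1 ≤ n then (h.isLipschitzLoop_sigma hn).h1LClass else 0) fun n hn => ?_
  rw [dif_pos hn, dif_pos (Nat.le_succ_of_le hn)]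
  exact h1LClass_sigma h hN hn

end

end HawaiianEarring

end

/-! ### The main theorem -/

theorem mainTheorem7 :
    (∃ N : ℕ → ℕ, Admissible N) ∧
    (∀ N : ℕ → ℕ, Admissible N →
      ∃ σ₁ : Set.Icc (0 : ℝ) 1 → Hawaiian,
        (IsSigmaOne N σ₁ ∧ ∀ σ' : Set.Icc (0 : ℝ) 1 → Hawaiian, IsSigmaOne N σ' → σ' = σ₁) ∧
        (∀ t : Set.Icc (0 : ℝ) 1, sigma σ₁ 1 t = σ₁ t) ∧
        ∃ hσ : ∀ n : ℕ, 1 ≤ n → IsLipschitzLoop Hawaiian.origin (2 * lam n) (sigma σ₁ n),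
          (∀ (n : ℕ) (hn : 2 ≤ n),
            (hσ (n - 1) (Nat.le_sub_of_add_le hn)).h1LClass =
              n • (hσ n (Nat.le_of_succ_le hn)).h1LClass) ∧
          (hσ 1 le_rfl).h1LClass ∈ maximalDivisible (H1L Hawaiian) ∧
          (hσ 1 le_rfl).pi1Class ∉ commutator (FundamentalGroup Hawaiian Hawaiian.origin) ∧
          comparison Hawaiian (hσ 1 le_rfl).h1LClass ≠ 0) ∧
    maximalDivisible (H1L Hawaiian) ≠ ⊥ ∧
    maximalDivisible (H1 Hawaiian) ≠ ⊥ := by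
  have key : ∀ N : ℕ → ℕ, ∀ hN : Admissible N,
      comparison Hawaiian
        ((isSigmaOne_sigmaOne hN).isLipschitzLoop_sigma le_rfl).h1LClass ≠ 0 := fun N hN =>
    IsLipschitzLoop.comparison_h1LClass_ne_zero _
      (pi1Class_sigma_notMem_commutator hN (isSigmaOne_sigmaOne hN))
  refine ⟨exists_admissible, fun N hN => ?_, ?_⟩
  · have h := isSigmaOne_sigmaOne hN
    refine ⟨sigmaOne N, ⟨h, fun σ' h' => h'.unique h⟩, sigma_one _,
      fun n hn => h.isLipschitzLoop_sigma hn, fun n hn => ?_, h1LClass_sigma_one_mem h hN,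
      pi1Class_sigma_notMem_commutator hN h, key N hN⟩
    obtain ⟨n, rfl⟩ := Nat.exists_eq_add_of_le' (Nat.le_of_succ_le hn)
    exact h1LClass_sigma h hN (by omega)
  · obtain ⟨N, hN⟩ := exists_admissible
    have h1 := h1LClass_sigma_one_mem (isSigmaOne_sigmaOne hN) hN
    have h2 := map_mem_maximalDivisible (comparison Hawaiian) h1
    constructor
    · intro e
      rw [e, AddSubgroup.mem_bot] at h1
      exact key N hN (by rw [h1, map_zero])
    · intro e
      rw [e, AddSubgroup.mem_bot] at h2
      exact key N hN h2
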